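/- **Setting.** Arities are generated by: if $\alpha_1,\dots,\alpha_n$ ($n\ge 0$) are arities, so is $(\alpha_1,\dots,\alpha_n)$. Fix constants and variables, each with an arity. *The framework $\mathrm{TF}_{\mathrm k}$.* Objects are $z[F_1,\dots,F_n]$, with $z$ an $(\alpha_1,\dots,\alpha_n)$-ary variable or constant and $F_i$ an $\alpha_i$-ary abstraction; $\alpha$-ary abstractions are $[\Delta]M$, with $\Delta$ an $\alpha$-ary context and $M$ an object; contexts are $x_1:K_1,\dots,x_n:K_n$, with $x_i$ distinct and $x_i$, $K_i$ of the same arity; $\alpha$-ary kinds are $(\Delta)T$ with $\Delta$ an $\alpha$-ary context and $T$ a base kind, $\mathbf{Type}$ or $\mathrm{El}(M)$. Expressions are taken up to $\alpha$-conversion. Instantiation $\{F/x\}X$, for $F$ and $x$ of the same arity, is defined by recursion on that arity and then on $X$: it commutes with all constructors, except that for $F\equiv[t_1:K_1,\dots,t_n:K_n]P$, $$\{F/x\}\,x[G_1,\dots,G_n]\equiv\{\{F/x\}G_1/t_1\}\cdots\{\{F/x\}G_n/t_n\}P .$$ For $\vec F=\langle F_1,\dots,F_n\rangle$ and $\Delta\equiv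 x_1:K_1,\dots,x_n:K_n$, $\{\vec F/\Delta\}$ instantiates each $F_i$ for $x_i$. The primitive judgements are $\Gamma\ \mathrm{valid}$, $\Gamma\vdash M:T$ and $\Gamma\vdash M=N:T$ with $T$ a base kind. The following judgements abbreviate sets of primitive ones: - $\Gamma\Vdash(\Delta)\mathbf{Type}\ \mathrm{kind}$ is $\{\Gamma,\Delta\ \mathrm{valid}\}$; $\Gamma\Vdash(\Delta)\mathrm{El}(A)\ \mathrm{kind}$ is $\{\Gamma,\Delta\vdash A:\mathbf{Type}\}$. - $\Gamma\Vdash\mathbf{Type}=\mathbf{Type}$ is $\{\Gamma\ \mathrm{valid}\}$; $\Gamma\Vdash\mathrm{El}(A)=\mathrm{El}(B)$ is $\{\Gamma\vdash A=B:\mathbf{Type}\}$; equality of $\mathbf{Type}$ with $\mathrm{El}(A)$ is undefined (not derivable). $\Gamma\Vdash\Delta=\Delta'$ consists of $\Gamma\ \mathrm{valid}$ and the $\Gamma,x_1:K_1,\dots,x_{i-1}:K_{i-1}\Vdash K_i=K_i'$; $\Gamma\Vdash(\Delta)T=(\Delta')T'$ consists of $\Gamma\Vdash\Delta=\Delta'$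 and $\Gamma,\Delta\Vdash T=T'$. - $\Gamma\Vdash[\Delta]M:(\Delta')T$ consists of $\Gamma\Vdash\Delta'=\Delta$ and $\Gamma,\Delta'\vdash M:T$; $\Gamma\Vdash[\Delta_1]M=[\Delta_2]N:(\Delta_3)T$ consists of $\Gamma\Vdash\Delta_3=\Delta_1$, $\Gamma\Vdash\Delta_3=\Delta_2$ and $\Gamma,\Delta_3\vdash M=N:T$. - $\Gamma\Vdash\vec F::\Delta$ consists of $\Gamma\ \mathrm{valid}$ and the $\Gamma\Vdash F_i:\{F_1/x_1,\dots,F_{i-1}/x_{i-1}\}K_i$; $\Gamma\Vdash\vec F=\vec G::\Delta$ consists of $\Gamma\ \mathrm{valid}$ and the $\Gamma\Vdash F_i=G_i:\{F_1/x_1,\dots,F_{i-1}/x_{i-1}\}K_i$. A *specification* is a set of constant declarations $c:K$ ($c$, $K$ of the same arity) and equation declarations $(\Delta)(M=N:T)$. The rules of deduction are: - $\langle\rangle\ \mathrm{valid}$; from $\Gamma\Vdash K\ \mathrm{kind}$ infer $\Gamma,x:K\ \mathrm{valid}$ ($x\notin\operatorname{dom}\Gamma$); - for $z:(\Delta)T$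 in $\Gamma$ or declared in the specification: from $\Gamma\Vdash\vec F::\Delta$ infer $\Gamma\vdash z\vec F:\{\vec F/\Delta\}T$, and from $\Gamma\Vdash\vec F=\vec G::\Delta$ infer $\Gamma\vdash z\vec F=z\vec G:\{\vec F/\Delta\}T$; - for each declared $(\Delta)(M=N:T)$: from $\Gamma\Vdash\vec F::\Delta$ infer $\Gamma\vdash\{\vec F/\Delta\}M=\{\vec F/\Delta\}N:\{\vec F/\Delta\}T$; - reflexivity (on objects with $\Gamma\vdash M:T$), symmetry and transitivity of equality; and from $\Gamma\vdash A=B:\mathbf{Type}$ and $\Gamma\vdash M:\mathrm{El}(A)$ (resp. $\Gamma\vdash M=N:\mathrm{El}(A)$) infer $\Gamma\vdash M:\mathrm{El}(B)$ (resp. $\Gamma\vdash M=N:\mathrm{El}(B)$). A specification $\mathcal T$ is *orderable* if its declarations have a well-ordering $\prec$ such that, using only the declarations $\delta'\prec\delta$, one can derive $\Delta\Vdash T\ \mathrm{kind}$ if $\delta$ is $c:(\Delta)T$, and $\Delta\vdash M:T$, $\Delta\vdash N:T$ and $\Delta\Vdash T\ \mathrm{kind}$ if $\delta$ is $(\Delta)(M=N:T)$.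 *The framework $\mathrm{LF}$* is Luo's Church-typed version of Martin-Löf's logical framework. Kinds and objects are given by $$K::=\mathbf{Type}\mid\mathrm{El}(k)\mid(x:K)K,\qquad k::=x\mid c\mid[x:K]k\mid kk,$$ and the judgements are $\Gamma\ \mathrm{valid}$, $\Gamma\vdash K\ \mathrm{kind}$, $\Gamma\vdash k:K$, $\Gamma\vdash k=k':K$ and $\Gamma\vdash K=K'$. The rules are the usual ones: context formation and assumption; equivalence rules for both equalities; conversion of typing and of object equality along equal kinds; substitution of an object, or of two equal objects, for a variable; formation and congruence for $\mathbf{Type}$, $\mathrm{El}$ and $(x:K)K'$; typing and congruence for abstraction and application; $\beta$ and $\eta$. A specification is a set of declarations $c:K$ (allowing $\Gamma\vdash c:K$ to be inferred from $\Gamma\ \mathrm{valid}$ and $\vdash K\ \mathrm{kind}$) and computation rules $k=k':K$ for $x_1:K_1,\dots,x_n:K_n$ (allowing $\Gamma\vdash\sigma k=\sigma k':\sigma K$ to be inferred, for a substitution $\sigma$, from $\Gamma\ \mathrm{valid}$, $\Gamma\vdash\sigma x_i:\sigma K_i$ for all $i$, $\Gamma\vdash\sigma k:\sigma K$ and $\Gamma\vdash\sigma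 k':\sigma K$). *The translation $\mathrm{lift}$* from $\mathrm{TF}_{\mathrm k}$ to $\mathrm{LF}$ sends $z[F_1,\dots,F_n]$ to $z\,\mathrm{lift}(F_1)\cdots\mathrm{lift}(F_n)$, $[x_1:K_1,\dots,x_n:K_n]M$ to $[x_1:\mathrm{lift}(K_1)]\cdots[x_n:\mathrm{lift}(K_n)]\mathrm{lift}(M)$, $\mathbf{Type}$ to $\mathbf{Type}$, $\mathrm{El}(M)$ to $\mathrm{El}(\mathrm{lift}(M))$, $(x:K)K'$ to $(x:\mathrm{lift}(K))\mathrm{lift}(K')$, and acts componentwise on contexts, judgements, declarations and specifications. **Theorem.** Let $\mathcal T$ be an orderable type theory specification in $\mathrm{TF}_{\mathrm k}$. If $\mathcal J$ is a judgement ($\Gamma\ \mathrm{valid}$, $\Gamma\vdash M:T$ or $\Gamma\vdash M=N:T$) derivable in $\mathrm{TF}_{\mathrm k}$ under $\mathcal T$, then $\mathrm{lift}(\mathcal J)$ is derivable in $\mathrm{LF}$ under $\mathrm{lift}(\mathcal T)$. -/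

import Mathlib

universe u

/-! ### The lambda-free framework with kind labels -/

namespace TFk

/-- Arities are finite sequences of arities: `nil` is the base arity `() = 0`, and
`cons α (α₁, …, αₙ)` is `(α, α₁, …, αₙ)`. -/
inductive Arity : Type
  | nil : Arity
  | cons (α β : Arity) : Arity

/-- A scope lists the arities of the variables that may occur free, most recent variable first.
Expressions are in de Bruijn form, so that `α`-convertible expressions are identical. -/
abbrev Scope : Type := List Arity

/-- The variables of arity `α` in a scope. -/
inductive Var : Scope → Arity → Type
  | zero {Φ : Scope} {α : Arity} : Var (α :: Φ) α
  | succ {Φ : Scope} {α β : Arity} (x : Var Φ α) : Var (β :: Φ) α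

/-- The syntactic categories: objects, `α`-ary abstraction sequences, `α`-ary abstractions and
`α`-ary kinds. -/
inductive Cat : Type
  | obj : Cat
  | args (α : Arity) : Cat
  | abs (α : Arity) : Cat
  | kind (α : Arity) : Cat

/-- The expressions over a set `C` of constants with arities `ar`. -/
inductive Exp {C : Type u} (ar : C → Arity) : Scope → Cat → Type u
  /-- the object `x F₁ … Fₙ`, for a variable `x` -/
  | var {Φ : Scope} {α : Arity} (x : Var Φ α) (Fs : Exp ar Φ (.args α)) : Exp ar Φ .obj
  /-- the object `c F₁ … Fₙ`, for a constant `c` -/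
  | const {Φ : Scope} (c : C) (Fs : Exp ar Φ (.args (ar c))) : Exp ar Φ .obj
  /-- the empty abstraction sequence -/
  | nil {Φ : Scope} : Exp ar Φ (.args .nil)
  /-- the abstraction sequence `F, F₁, …, Fₙ` -/
  | cons {Φ : Scope} {α β : Arity} (F : Exp ar Φ (.abs α)) (Fs : Exp ar Φ (.args β)) :
      Exp ar Φ (.args (.cons α β))
  /-- the abstraction `[]M` -/
  | body {Φ : Scope} (M : Exp ar Φ .obj) : Exp ar Φ (.abs .nil)
  /-- the abstraction `[x : K, Δ]M`, where `F` is `[Δ]M` -/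
  | lam {Φ : Scope} {α β : Arity} (K : Exp ar Φ (.kind α)) (F : Exp ar (α :: Φ) (.abs β)) :
      Exp ar Φ (.abs (.cons α β))
  /-- the base kind `Type` -/
  | type {Φ : Scope} : Exp ar Φ (.kind .nil)
  /-- the base kind `El(M)` -/
  | el {Φ : Scope} (M : Exp ar Φ .obj) : Exp ar Φ (.kind .nil)
  /-- the kind `(x : K, Δ)T`, where `K'` is `(Δ)T` -/
  | pi {Φ : Scope} {α β : Arity} (K : Exp ar Φ (.kind α)) (K' : Exp ar (α :: Φ) (.kind β)) :
      Exp ar Φ (.kind (.cons α β))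

section

variable {C : Type u} (ar : C → Arity)

/-- Objects. -/
abbrev Obj (Φ : Scope) : Type u := Exp ar Φ .obj

/-- Abstraction sequences of arity `α`. -/
abbrev Args (Φ : Scope) (α : Arity) : Type u := Exp ar Φ (.args α)

/-- Abstractions of arity `α`. -/
abbrev Abs (Φ : Scope) (α : Arity) : Type u := Exp ar Φ (.abs α)

/-- Kinds of arity `α`. -/
abbrev Kind (Φ : Scope) (α : Arity) : Type u := Exp ar Φ (.kind α)

/-- Base kinds: `Type` and `El(M)`. -/
abbrev BaseKind (Φ : Scope) : Type u := Kind ar Φ .nil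

end

/-- Renamings of variables. -/
def Ren (Φ Ψ : Scope) : Type := ∀ α : Arity, Var Φ α → Var Ψ α

/-- Extend a renaming under a binder. -/
def Ren.up {Φ Ψ : Scope} (ρ : Ren Φ Ψ) (β : Arity) : Ren (β :: Φ) (β :: Ψ)
  | _, .zero => .zero
  | _, .succ x => .succ (ρ _ x)

/-- The renaming that skips the most recent variable. -/
def Ren.wk (Φ : Scope) (β : Arity) : Ren Φ (β :: Φ) := fun _ x => .succ x

/-- The renaming of the empty scope into any scope. -/
def Ren.closed (Φ : Scope) : Ren [] Φ := fun _ x => nomatch x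

section

variable {C : Type u} {ar : C → Arity}

/-- Apply a renaming to an expression. -/
def Exp.rename {Φ Ψ : Scope} {s : Cat} (ρ : Ren Φ Ψ) : Exp ar Φ s → Exp ar Ψ s
  | .var x Fs => .var (ρ _ x) (Fs.rename ρ)
  | .const c Fs => .const c (Fs.rename ρ)
  | .nil => .nil
  | .cons F Fs => .cons (F.rename ρ) (Fs.rename ρ)
  | .body M => .body (M.rename ρ)
  | .lam K F => .lam (K.rename ρ) (F.rename (ρ.up _))
  | .type => .type
  | .el M => .el (M.rename ρ)
  | .pi K K' => .pi (K.rename ρ) (K'.rename (ρ.up _))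

/-- What an instantiation of one `α`-ary variable does to a `β`-ary variable: it either renames
it or, when `β = α`, replaces it by an abstraction. -/
inductive Img (ar : C → Arity) (α : Arity) (Ψ : Scope) : Arity → Type u
  | var {β : Arity} (y : Var Ψ β) : Img ar α Ψ β
  | abs (F : Abs ar Ψ α) : Img ar α Ψ α

/-- Rename the variables in an image. -/
def Img.rename {α : Arity} {Ψ Ψ' : Scope} (ρ : Ren Ψ Ψ') {β : Arity} :
    Img ar α Ψ β → Img ar α Ψ' β
  | .var y => .var (ρ _ y)
  | .abs F => .abs (F.rename ρ)

/-- Apply an image to an abstraction sequence, given the operation `emp` of employing an `α`-ary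
abstraction on an abstraction sequence. -/
def Img.apply {α : Arity} {Ψ : Scope} (emp : Abs ar Ψ α → Args ar Ψ α → Obj ar Ψ) {β : Arity} :
    Img ar α Ψ β → Args ar Ψ β → Obj ar Ψ
  | .var y, Gs => .var y Gs
  | .abs F, Gs => emp F Gs

/-- Assignments of images to the variables of a scope. -/
def Inst (ar : C → Arity) (α : Arity) (Φ Ψ : Scope) : Type u :=
  ∀ β : Arity, Var Φ β → Img ar α Ψ β

/-- Extend an assignment under a binder. -/
def Inst.up {α : Arity} {Φ Ψ : Scope} (σ : Inst ar α Φ Ψ) (γ : Arity) :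
    Inst ar α (γ :: Φ) (γ :: Ψ)
  | _, .zero => .var .zero
  | _, .succ x => (σ _ x).rename (Ren.wk Ψ γ)

/-- The assignment that replaces the most recent variable by `F` and fixes all others. -/
def Inst.single {α : Arity} {Φ : Scope} (F : Abs ar Φ α) : Inst ar α (α :: Φ) Φ
  | _, .zero => .abs F
  | _, .succ x => .var x

/-- Instantiation of `α`-ary variables, relative to the operation `emp` of employing an `α`-ary
abstraction on an abstraction sequence:
`{F/x} z[G₁, …, Gₙ] = z[{F/x}G₁, …, {F/x}Gₙ]` for `z ≠ x`, and
`{F/x} x[G₁, …, Gₙ] = F • {F/x}G₁ • ⋯ • {F/x}Gₙ`. -/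
def Exp.instWith {α : Arity} (emp : ∀ Ψ : Scope, Abs ar Ψ α → Args ar Ψ α → Obj ar Ψ)
    {Φ Ψ : Scope} {s : Cat} (σ : Inst ar α Φ Ψ) : Exp ar Φ s → Exp ar Ψ s
  | .var x Fs => (σ _ x).apply (emp Ψ) (Fs.instWith emp σ)
  | .const c Fs => .const c (Fs.instWith emp σ)
  | .nil => .nil
  | .cons F Fs => .cons (F.instWith emp σ) (Fs.instWith emp σ)
  | .body M => .body (M.instWith emp σ)
  | .lam K F => .lam (K.instWith emp σ) (F.instWith emp (σ.up _))
  | .type => .type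
  | .el M => .el (M.instWith emp σ)
  | .pi K K' => .pi (K.instWith emp σ) (K'.instWith emp (σ.up _))

/-- Employment of an `α`-ary abstraction on an `α`-ary abstraction sequence, by recursion on `α`:
`([x : K]F) • G • Gs = ({G/x}F) • Gs`. For `F = [t₁ : K₁, …, tₙ : Kₙ]P` this is
`{G₁/t₁} ⋯ {Gₙ/tₙ} P`, since no `tᵢ` is free in any `Gⱼ`. -/
def employ : (α : Arity) → (Ψ : Scope) → Abs ar Ψ α → Args ar Ψ α → Obj ar Ψ
  | .nil, _, .body M, .nil => M
  | .cons α β, Ψ, .lam _ F, .cons G Gs =>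
      employ β Ψ (F.instWith (employ α) (Inst.single G)) Gs

/-- Instantiation `{F/x}X`, where `x` is the most recent variable of the scope of `X`. -/
def Exp.inst {α : Arity} {Φ : Scope} {s : Cat} (X : Exp ar (α :: Φ) s) (F : Abs ar Φ α) :
    Exp ar Φ s :=
  X.instWith (employ α) (Inst.single F)

/-- For a kind `(Δ)T` and an abstraction sequence `Fs` of the same arity, the base kind
`{Fs/Δ}T`. -/
def instResult : (α : Arity) → {Φ : Scope} → Kind ar Φ α → Args ar Φ α → BaseKind ar Φ
  | .nil, _, T, _ => T
  | .cons _ β, _, .pi _ K', .cons F Fs => instResult β (K'.inst F) Fs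

/-- Contexts `x₁ : K₁, …, xₙ : Kₙ`. -/
inductive Ctx (ar : C → Arity) : Scope → Type u
  | nil : Ctx ar []
  | snoc {Φ : Scope} {α : Arity} (Γ : Ctx ar Φ) (K : Kind ar Φ α) : Ctx ar (α :: Φ)

/-- The kind of a variable in a context. -/
def Ctx.lookup {Φ : Scope} {α : Arity} : Ctx ar Φ → Var Φ α → Kind ar Φ α
  | .snoc (Φ := Φ) (α := β) _ K, .zero => K.rename (Ren.wk Φ β)
  | .snoc (Φ := Φ) (α := β) Γ _, .succ x => (Γ.lookup x).rename (Ren.wk Φ β)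

/-- The arity of `(Δ)K` and of `[Δ]F`, where `Δ` has scope `Φ` and `K`, `F` have arity `α`. -/
def closeArity : Scope → Arity → Arity
  | [], α => α
  | β :: Φ, α => closeArity Φ (.cons β α)

/-- The kind `(Δ)K`. -/
def Ctx.pis {Φ : Scope} {α : Arity} : Ctx ar Φ → Kind ar Φ α → Kind ar [] (closeArity Φ α)
  | .nil, K => K
  | .snoc Δ J, K => Δ.pis (.pi J K)

/-- The abstraction `[Δ]F`. -/
def Ctx.lams {Φ : Scope} {α : Arity} : Ctx ar Φ → Abs ar Φ α → Abs ar [] (closeArity Φ α)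
  | .nil, F => F
  | .snoc Δ J, F => Δ.lams (.lam J F)

/-- The primitive judgements `Γ valid`, `Γ ⊢ M : T` and `Γ ⊢ M = N : T`. -/
inductive Judgement (ar : C → Arity) : Type u
  | valid {Φ : Scope} (Γ : Ctx ar Φ) : Judgement ar
  | ofKind {Φ : Scope} (Γ : Ctx ar Φ) (M : Obj ar Φ) (T : BaseKind ar Φ) : Judgement ar
  | eq {Φ : Scope} (Γ : Ctx ar Φ) (M N : Obj ar Φ) (T : BaseKind ar Φ) : Judgement ar

/-- A defined judgement is a set of primitive judgements, unless it is left undefined. -/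
structure DefinedJudgement (ar : C → Arity) : Type u where
  isDefined : Prop
  primitives : Set (Judgement ar)

/-- The defined judgement given by a set of primitive judgements. -/
def DefinedJudgement.of (S : Set (Judgement ar)) : DefinedJudgement ar := ⟨True, S⟩

/-- The undefined judgement. -/
def DefinedJudgement.undefined : DefinedJudgement ar := ⟨False, ∅⟩

/-- The union of two defined judgements; it is undefined if one of them is. -/
def DefinedJudgement.union (D E : DefinedJudgement ar) : DefinedJudgement ar :=
  ⟨D.isDefined ∧ E.isDefined, D.primitives ∪ E.primitives⟩

/-- `Γ ⊩ K kind`; for `K = (Δ)T` this is `Γ, Δ ⊩ T kind`. -/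
def kindJ : (α : Arity) → {Φ : Scope} → Ctx ar Φ → Kind ar Φ α → DefinedJudgement ar
  | .nil, _, Γ, .type => .of {.valid Γ}
  | .nil, _, Γ, .el M => .of {.ofKind Γ M .type}
  | .cons _ β, _, Γ, .pi K K' => kindJ β (Γ.snoc K) K'

/-- `Γ ⊩ K = K'`; for `K = (x₁ : K₁, …, xₙ : Kₙ)T` and `K' = (x₁ : K₁', …, xₙ : Kₙ')T'` it
consists of the judgements `Γ, x₁ : K₁, …, xᵢ₋₁ : Kᵢ₋₁ ⊩ Kᵢ = Kᵢ'` together with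
`Γ, x₁ : K₁, …, xₙ : Kₙ ⊩ T = T'`. (Here and below there is no need to list `Γ valid`
separately, as it is derivable whenever some other judgement with context `Γ, Δ` is.) -/
def kindEqJ : (α : Arity) → {Φ : Scope} → Ctx ar Φ → Kind ar Φ α → Kind ar Φ α →
    DefinedJudgement ar
  | .nil, _, Γ, .type, .type => .of {.valid Γ}
  | .nil, _, Γ, .el A, .el B => .of {.eq Γ A B .type}
  | .nil, _, _, .type, .el _ => .undefined
  | .nil, _, _, .el _, .type => .undefined
  | .cons α β, _, Γ, .pi K L, .pi K' L' => (kindEqJ α Γ K K').union (kindEqJ β (Γ.snoc K) L L')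

/-- `Γ ⊩ F : K`; for `F = [Δ]M` and `K = (Δ')T` it consists of `Γ ⊩ Δ' = Δ` and
`Γ, Δ' ⊢ M : T`. -/
def absJ : (α : Arity) → {Φ : Scope} → Ctx ar Φ → Abs ar Φ α → Kind ar Φ α →
    DefinedJudgement ar
  | .nil, _, Γ, .body M, T => .of {.ofKind Γ M T}
  | .cons α β, _, Γ, .lam J F, .pi K K' =>
      (kindEqJ α Γ K J).union (absJ β (Γ.snoc K) F K')

/-- `Γ ⊩ F = G : K`; for `F = [Δ₁]M`, `G = [Δ₂]N` and `K = (Δ₃)T` it consists of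
`Γ ⊩ Δ₃ = Δ₁`, `Γ ⊩ Δ₃ = Δ₂` and `Γ, Δ₃ ⊢ M = N : T`. -/
def absEqJ : (α : Arity) → {Φ : Scope} → Ctx ar Φ → Abs ar Φ α → Abs ar Φ α → Kind ar Φ α →
    DefinedJudgement ar
  | .nil, _, Γ, .body M, .body N, T => .of {.eq Γ M N T}
  | .cons α β, _, Γ, .lam J₁ F, .lam J₂ G, .pi K K' =>
      ((kindEqJ α Γ K J₁).union (kindEqJ α Γ K J₂)).union (absEqJ β (Γ.snoc K) F G K')

/-- `Γ ⊩ Fs :: Δ`, where `Δ` is given through a kind `(Δ)T`: it consists of `Γ valid` and the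
judgements `Γ ⊩ Fᵢ : {F₁/x₁, …, Fᵢ₋₁/xᵢ₋₁}Kᵢ`. -/
def seqJ : (α : Arity) → {Φ : Scope} → Ctx ar Φ → Args ar Φ α → Kind ar Φ α →
    DefinedJudgement ar
  | .nil, _, Γ, _, _ => .of {.valid Γ}
  | .cons α β, _, Γ, .cons F Fs, .pi K K' =>
      (absJ α Γ F K).union (seqJ β Γ Fs (K'.inst F))

/-- `Γ ⊩ Fs = Gs :: Δ`, where `Δ` is given through a kind `(Δ)T`: it consists of `Γ valid` and
the judgements `Γ ⊩ Fᵢ = Gᵢ : {F₁/x₁, …, Fᵢ₋₁/xᵢ₋₁}Kᵢ`. -/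
def seqEqJ : (α : Arity) → {Φ : Scope} → Ctx ar Φ → Args ar Φ α → Args ar Φ α → Kind ar Φ α →
    DefinedJudgement ar
  | .nil, _, Γ, _, _, _ => .of {.valid Γ}
  | .cons α β, _, Γ, .cons F Fs, .cons G Gs, .pi K K' =>
      (absEqJ α Γ F G K).union (seqEqJ β Γ Fs Gs (K'.inst F))

/-- Declarations: constant declarations `c : K` and equation declarations `(Δ)(M = N : T)`. -/
inductive Decl (ar : C → Arity) : Type u
  | const (c : C) (K : Kind ar [] (ar c)) : Decl ar
  | eq {Φ : Scope} (Δ : Ctx ar Φ) (M N : Obj ar Φ) (T : BaseKind ar Φ) : Decl ar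

/-- Type theory specifications. -/
abbrev Spec (ar : C → Arity) : Type u := Set (Decl ar)

/-- The primitive judgements derivable under a specification. -/
inductive Derivable (S : Spec ar) : Judgement ar → Prop
  | emp_ctxt : Derivable S (.valid .nil)
  | ctxt {Φ : Scope} {α : Arity} {Γ : Ctx ar Φ} {K : Kind ar Φ α}
      (hd : (kindJ α Γ K).isDefined)
      (h : ∀ J ∈ (kindJ α Γ K).primitives, Derivable S J) :
      Derivable S (.valid (Γ.snoc K))
  | var {Φ : Scope} {α : Arity} {Γ : Ctx ar Φ} (x : Var Φ α) {Fs : Args ar Φ α}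
      (hd : (seqJ α Γ Fs (Γ.lookup x)).isDefined)
      (h : ∀ J ∈ (seqJ α Γ Fs (Γ.lookup x)).primitives, Derivable S J) :
      Derivable S (.ofKind Γ (.var x Fs) (instResult α (Γ.lookup x) Fs))
  | var_eq {Φ : Scope} {α : Arity} {Γ : Ctx ar Φ} (x : Var Φ α) {Fs Gs : Args ar Φ α}
      (hd : (seqEqJ α Γ Fs Gs (Γ.lookup x)).isDefined)
      (h : ∀ J ∈ (seqEqJ α Γ Fs Gs (Γ.lookup x)).primitives, Derivable S J) :
      Derivable S (.eq Γ (.var x Fs) (.var x Gs) (instResult α (Γ.lookup x) Fs))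
  | ref {Φ : Scope} {Γ : Ctx ar Φ} {M : Obj ar Φ} {T : BaseKind ar Φ}
      (h : Derivable S (.ofKind Γ M T)) : Derivable S (.eq Γ M M T)
  | sym {Φ : Scope} {Γ : Ctx ar Φ} {M N : Obj ar Φ} {T : BaseKind ar Φ}
      (h : Derivable S (.eq Γ M N T)) : Derivable S (.eq Γ N M T)
  | trans {Φ : Scope} {Γ : Ctx ar Φ} {M N P : Obj ar Φ} {T : BaseKind ar Φ}
      (h₁ : Derivable S (.eq Γ M N T)) (h₂ : Derivable S (.eq Γ N P T)) :
      Derivable S (.eq Γ M P T)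
  | conv {Φ : Scope} {Γ : Ctx ar Φ} {M A B : Obj ar Φ}
      (h₁ : Derivable S (.ofKind Γ M (.el A))) (h₂ : Derivable S (.eq Γ A B .type)) :
      Derivable S (.ofKind Γ M (.el B))
  | conv_eq {Φ : Scope} {Γ : Ctx ar Φ} {M N A B : Obj ar Φ}
      (h₁ : Derivable S (.eq Γ M N (.el A))) (h₂ : Derivable S (.eq Γ A B .type)) :
      Derivable S (.eq Γ M N (.el B))
  | const {Φ : Scope} {Γ : Ctx ar Φ} {c : C} {K : Kind ar [] (ar c)} {Fs : Args ar Φ (ar c)}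
      (hc : Decl.const c K ∈ S)
      (hd : (seqJ (ar c) Γ Fs (K.rename (Ren.closed Φ))).isDefined)
      (h : ∀ J ∈ (seqJ (ar c) Γ Fs (K.rename (Ren.closed Φ))).primitives, Derivable S J) :
      Derivable S
        (.ofKind Γ (.const c Fs) (instResult (ar c) (K.rename (Ren.closed Φ)) Fs))
  | const_eq {Φ : Scope} {Γ : Ctx ar Φ} {c : C} {K : Kind ar [] (ar c)}
      {Fs Gs : Args ar Φ (ar c)}
      (hc : Decl.const c K ∈ S)
      (hd : (seqEqJ (ar c) Γ Fs Gs (K.rename (Ren.closed Φ))).isDefined)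
      (h : ∀ J ∈ (seqEqJ (ar c) Γ Fs Gs (K.rename (Ren.closed Φ))).primitives,
        Derivable S J) :
      Derivable S
        (.eq Γ (.const c Fs) (.const c Gs) (instResult (ar c) (K.rename (Ren.closed Φ)) Fs))
  | eq {Φ Θ : Scope} {Γ : Ctx ar Φ} {Δ : Ctx ar Θ} {M N : Obj ar Θ} {T : BaseKind ar Θ}
      {Fs : Args ar Φ (closeArity Θ .nil)}
      (he : Decl.eq Δ M N T ∈ S)
      (hd : (seqJ _ Γ Fs ((Δ.pis T).rename (Ren.closed Φ))).isDefined)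
      (h : ∀ J ∈ (seqJ _ Γ Fs ((Δ.pis T).rename (Ren.closed Φ))).primitives,
        Derivable S J) :
      Derivable S
        (.eq Γ (employ _ Φ ((Δ.lams (.body M)).rename (Ren.closed Φ)) Fs)
          (employ _ Φ ((Δ.lams (.body N)).rename (Ren.closed Φ)) Fs)
          (instResult _ ((Δ.pis T).rename (Ren.closed Φ)) Fs))

/-- A defined judgement is derivable when it is defined and all its members are derivable. -/
def DerivableD (S : Spec ar) (D : DefinedJudgement ar) : Prop :=
  D.isDefined ∧ ∀ J ∈ D.primitives, Derivable S J

/-- A declaration is well-formed relative to `S`: for `c : (Δ)T`, the judgement `Δ ⊩ T kind` is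
derivable under `S`; for `(Δ)(M = N : T)`, the judgements `Δ ⊢ M : T`, `Δ ⊢ N : T` and
`Δ ⊩ T kind` are. -/
def Decl.WellFormed (S : Spec ar) : Decl ar → Prop
  | .const c K => DerivableD S (kindJ (ar c) .nil K)
  | .eq Δ M N T =>
      Derivable S (.ofKind Δ M T) ∧ Derivable S (.ofKind Δ N T) ∧
        DerivableD S (kindJ .nil Δ T)

/-- A specification is orderable if its declarations can be well-ordered in such a way that each
is well-formed relative to the declarations that precede it. -/
def Spec.Orderable (S : Spec ar) : Prop :=
  ∃ r : {δ : Decl ar // δ ∈ S} → {δ : Decl ar // δ ∈ S} → Prop, IsWellOrder _ r ∧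
    ∀ δ : {δ : Decl ar // δ ∈ S}, δ.1.WellFormed {δ' | ∃ h : δ' ∈ S, r ⟨δ', h⟩ δ}

end

end TFk

/-! ### The traditional framework with abstraction, application and product kinds -/

namespace LF

/-- The syntactic categories: objects and kinds. -/
inductive Cat : Type
  | obj : Cat
  | kind : Cat

/-- The expressions over a set `C` of constants, with free variables in `Fin n`
(`0` is the most recent variable). -/
inductive Exp (C : Type u) : ℕ → Cat → Type u
  /-- the kind `Type` -/
  | type {n : ℕ} : Exp C n .kind
  /-- the kind `El(k)` -/
  | el {n : ℕ} (k : Exp C n .obj) : Exp C n .kind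
  /-- the kind `(x : K)K'` -/
  | pi {n : ℕ} (K : Exp C n .kind) (K' : Exp C (n + 1) .kind) : Exp C n .kind
  /-- a variable -/
  | var {n : ℕ} (i : Fin n) : Exp C n .obj
  /-- a constant -/
  | const {n : ℕ} (c : C) : Exp C n .obj
  /-- the object `[x : K]k` -/
  | lam {n : ℕ} (K : Exp C n .kind) (k : Exp C (n + 1) .obj) : Exp C n .obj
  /-- the object `k k'` -/
  | app {n : ℕ} (k k' : Exp C n .obj) : Exp C n .obj

/-- Objects. -/
abbrev Obj (C : Type u) (n : ℕ) : Type u := Exp C n .obj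

/-- Kinds. -/
abbrev Kind (C : Type u) (n : ℕ) : Type u := Exp C n .kind

section

variable {C : Type u}

/-- Extend a renaming under a binder. -/
def upRen {n m : ℕ} (ρ : Fin n → Fin m) : Fin (n + 1) → Fin (m + 1) :=
  Fin.cases 0 (fun i => (ρ i).succ)

/-- Apply a renaming to an expression. -/
def Exp.rename {n m : ℕ} {s : Cat} (ρ : Fin n → Fin m) : Exp C n s → Exp C m s
  | .type => .type
  | .el k => .el (k.rename ρ)
  | .pi K K' => .pi (K.rename ρ) (K'.rename (upRen ρ))
  | .var i => .var (ρ i)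
  | .const c => .const c
  | .lam K k => .lam (K.rename ρ) (k.rename (upRen ρ))
  | .app k k' => .app (k.rename ρ) (k'.rename ρ)

/-- Weakening by one variable. -/
def Exp.wk {n : ℕ} {s : Cat} (X : Exp C n s) : Exp C (n + 1) s := X.rename Fin.succ

/-- Simultaneous substitutions. -/
abbrev Sub (C : Type u) (n m : ℕ) : Type u := Fin n → Obj C m

/-- Extend a substitution under a binder. -/
def Sub.up {n m : ℕ} (σ : Sub C n m) : Sub C (n + 1) (m + 1) :=
  Fin.cases (.var 0) (fun i => (σ i).wk)

/-- Extend a substitution under `j` binders. -/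
def Sub.upN {n m : ℕ} (σ : Sub C n m) : (j : ℕ) → Sub C (n + j) (m + j)
  | 0 => σ
  | j + 1 => (σ.upN j).up

/-- Apply a (capture-avoiding) substitution to an expression. -/
def Exp.subst {n m : ℕ} {s : Cat} (σ : Sub C n m) : Exp C n s → Exp C m s
  | .type => .type
  | .el k => .el (k.subst σ)
  | .pi K K' => .pi (K.subst σ) (K'.subst σ.up)
  | .var i => σ i
  | .const c => .const c
  | .lam K k => .lam (K.subst σ) (k.subst σ.up)
  | .app k k' => .app (k.subst σ) (k'.subst σ)

/-- The substitution `[k/x]` for the most recent variable `x`. -/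
def single {n : ℕ} (k : Obj C n) : Sub C (n + 1) n := Fin.cases k .var

/-- `[k/x]X` for the most recent variable `x`. -/
def Exp.inst {n : ℕ} {s : Cat} (X : Exp C (n + 1) s) (k : Obj C n) : Exp C n s :=
  X.subst (single k)

/-- Contexts of length `n`. -/
inductive Ctx (C : Type u) : ℕ → Type u
  | nil : Ctx C 0
  | snoc {n : ℕ} (Γ : Ctx C n) (K : Kind C n) : Ctx C (n + 1)

/-- The kind of a variable in a context. -/
def Ctx.lookup : {n : ℕ} → Ctx C n → Fin n → Kind C n
  | _ + 1, .snoc Γ K, i => Fin.cases K.wk (fun j => (Γ.lookup j).wk) i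

/-- Context extensions `x₁ : K₁, …, xⱼ : Kⱼ` of length `j` over `n` variables. -/
inductive Tele (C : Type u) (n : ℕ) : ℕ → Type u
  | nil : Tele C n 0
  | snoc {j : ℕ} (Δ : Tele C n j) (K : Kind C (n + j)) : Tele C n (j + 1)

/-- The context `Γ, Δ`. -/
def Ctx.append {n : ℕ} (Γ : Ctx C n) : {j : ℕ} → Tele C n j → Ctx C (n + j)
  | _, .nil => Γ
  | _, .snoc Δ K => (Γ.append Δ).snoc K

/-- Apply a substitution to a context extension. -/
def Tele.subst {n m : ℕ} (σ : Sub C n m) : {j : ℕ} → Tele C n j → Tele C m j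
  | _, .nil => .nil
  | j + 1, .snoc Δ K => (Δ.subst σ).snoc (K.subst (σ.upN j))

/-- The bodies of the five judgement forms `Γ valid`, `Γ ⊢ K kind`, `Γ ⊢ k : K`,
`Γ ⊢ k = k' : K` and `Γ ⊢ K = K'`. -/
inductive Body (C : Type u) (n : ℕ) : Type u
  | valid : Body C n
  | kind (K : Kind C n) : Body C n
  | ofKind (k : Obj C n) (K : Kind C n) : Body C n
  | eq (k k' : Obj C n) (K : Kind C n) : Body C n
  | kindEq (K K' : Kind C n) : Body C n

/-- Apply a substitution to a judgement body. -/
def Body.subst {n m : ℕ} (σ : Sub C n m) : Body C n → Body C m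
  | .valid => .valid
  | .kind K => .kind (K.subst σ)
  | .ofKind k K => .ofKind (k.subst σ) (K.subst σ)
  | .eq k k' K => .eq (k.subst σ) (k'.subst σ) (K.subst σ)
  | .kindEq K K' => .kindEq (K.subst σ) (K'.subst σ)

/-- Judgements. -/
structure Judgement (C : Type u) : Type u where
  length : ℕ
  ctx : Ctx C length
  body : Body C length

/-- Declarations: constant declarations `c : K`, and computation rules
`k = k' : K for x₁ : K₁, …, xₙ : Kₙ`. -/
inductive Decl (C : Type u) : Type u
  | const (c : C) (K : Kind C 0) : Decl C
  | eq {m : ℕ} (Δ : Ctx C m) (k k' : Obj C m) (K : Kind C m) : Decl C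

/-- Type theory specifications. -/
abbrev Spec (C : Type u) : Type u := Set (Decl C)

/-- The rules of deduction, under a specification `S`. -/
inductive Der (S : Spec C) : {n : ℕ} → Ctx C n → Body C n → Prop
  -- contexts and assumptions
  | emp : Der S .nil .valid
  | ctxt {n : ℕ} {Γ : Ctx C n} {K : Kind C n} (h : Der S Γ (.kind K)) :
      Der S (Γ.snoc K) .valid
  | var {n : ℕ} {Γ : Ctx C n} (i : Fin n) (h : Der S Γ .valid) :
      Der S Γ (.ofKind (.var i) (Γ.lookup i))
  -- general equality rules
  | kind_refl {n : ℕ} {Γ : Ctx C n} {K : Kind C n} (h : Der S Γ (.kind K)) :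
      Der S Γ (.kindEq K K)
  | kind_symm {n : ℕ} {Γ : Ctx C n} {K K' : Kind C n} (h : Der S Γ (.kindEq K K')) :
      Der S Γ (.kindEq K' K)
  | kind_trans {n : ℕ} {Γ : Ctx C n} {K K' K'' : Kind C n} (h₁ : Der S Γ (.kindEq K K'))
      (h₂ : Der S Γ (.kindEq K' K'')) : Der S Γ (.kindEq K K'')
  | refl {n : ℕ} {Γ : Ctx C n} {k : Obj C n} {K : Kind C n} (h : Der S Γ (.ofKind k K)) :
      Der S Γ (.eq k k K)
  | symm {n : ℕ} {Γ : Ctx C n} {k k' : Obj C n} {K : Kind C n} (h : Der S Γ (.eq k k' K)) :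
      Der S Γ (.eq k' k K)
  | trans {n : ℕ} {Γ : Ctx C n} {k k' k'' : Obj C n} {K : Kind C n}
      (h₁ : Der S Γ (.eq k k' K)) (h₂ : Der S Γ (.eq k' k'' K)) : Der S Γ (.eq k k'' K)
  -- equality typing rules
  | conv {n : ℕ} {Γ : Ctx C n} {k : Obj C n} {K K' : Kind C n} (h₁ : Der S Γ (.ofKind k K))
      (h₂ : Der S Γ (.kindEq K K')) : Der S Γ (.ofKind k K')
  | conv_eq {n : ℕ} {Γ : Ctx C n} {k k' : Obj C n} {K K' : Kind C n}
      (h₁ : Der S Γ (.eq k k' K)) (h₂ : Der S Γ (.kindEq K K')) : Der S Γ (.eq k k' K')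
  -- substitution rules
  | subst {n j : ℕ} {Γ : Ctx C n} {K : Kind C n} {Δ : Tele C (n + 1) j}
      {J : Body C (n + 1 + j)} {k : Obj C n}
      (h₁ : Der S ((Γ.snoc K).append Δ) J) (h₂ : Der S Γ (.ofKind k K)) :
      Der S (Γ.append (Δ.subst (single k))) (J.subst ((single k).upN j))
  | subst_kind_eq {n j : ℕ} {Γ : Ctx C n} {K : Kind C n} {Δ : Tele C (n + 1) j}
      {K' : Kind C (n + 1 + j)} {k₁ k₂ : Obj C n}
      (h₁ : Der S ((Γ.snoc K).append Δ) (.kind K')) (h₂ : Der S Γ (.eq k₁ k₂ K)) :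
      Der S (Γ.append (Δ.subst (single k₁)))
        (.kindEq (K'.subst ((single k₁).upN j)) (K'.subst ((single k₂).upN j)))
  | subst_eq {n j : ℕ} {Γ : Ctx C n} {K : Kind C n} {Δ : Tele C (n + 1) j}
      {k' : Obj C (n + 1 + j)} {K' : Kind C (n + 1 + j)} {k₁ k₂ : Obj C n}
      (h₁ : Der S ((Γ.snoc K).append Δ) (.ofKind k' K')) (h₂ : Der S Γ (.eq k₁ k₂ K)) :
      Der S (Γ.append (Δ.subst (single k₁)))
        (.eq (k'.subst ((single k₁).upN j)) (k'.subst ((single k₂).upN j))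
          (K'.subst ((single k₁).upN j)))
  -- the kind `Type`
  | type {n : ℕ} {Γ : Ctx C n} (h : Der S Γ .valid) : Der S Γ (.kind .type)
  | el {n : ℕ} {Γ : Ctx C n} {A : Obj C n} (h : Der S Γ (.ofKind A .type)) :
      Der S Γ (.kind (.el A))
  | el_eq {n : ℕ} {Γ : Ctx C n} {A B : Obj C n} (h : Der S Γ (.eq A B .type)) :
      Der S Γ (.kindEq (.el A) (.el B))
  -- dependent product kinds
  | pi {n : ℕ} {Γ : Ctx C n} {K : Kind C n} {K' : Kind C (n + 1)} (h₁ : Der S Γ (.kind K))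
      (h₂ : Der S (Γ.snoc K) (.kind K')) : Der S Γ (.kind (.pi K K'))
  | pi_eq {n : ℕ} {Γ : Ctx C n} {K₁ K₂ : Kind C n} {K₁' K₂' : Kind C (n + 1)}
      (h₁ : Der S Γ (.kindEq K₁ K₂)) (h₂ : Der S (Γ.snoc K₁) (.kindEq K₁' K₂')) :
      Der S Γ (.kindEq (.pi K₁ K₁') (.pi K₂ K₂'))
  | lam {n : ℕ} {Γ : Ctx C n} {K : Kind C n} {k : Obj C (n + 1)} {K' : Kind C (n + 1)}
      (h : Der S (Γ.snoc K) (.ofKind k K')) : Der S Γ (.ofKind (.lam K k) (.pi K K'))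
  | lam_eq {n : ℕ} {Γ : Ctx C n} {K₁ K₂ : Kind C n} {k₁ k₂ : Obj C (n + 1)}
      {K' : Kind C (n + 1)}
      (h₁ : Der S Γ (.kindEq K₁ K₂)) (h₂ : Der S (Γ.snoc K₁) (.eq k₁ k₂ K')) :
      Der S Γ (.eq (.lam K₁ k₁) (.lam K₂ k₂) (.pi K₁ K'))
  | app {n : ℕ} {Γ : Ctx C n} {f k : Obj C n} {K : Kind C n} {K' : Kind C (n + 1)}
      (h₁ : Der S Γ (.ofKind f (.pi K K'))) (h₂ : Der S Γ (.ofKind k K)) :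
      Der S Γ (.ofKind (.app f k) (K'.inst k))
  | app_eq {n : ℕ} {Γ : Ctx C n} {f f' k₁ k₂ : Obj C n} {K : Kind C n} {K' : Kind C (n + 1)}
      (h₁ : Der S Γ (.eq f f' (.pi K K'))) (h₂ : Der S Γ (.eq k₁ k₂ K)) :
      Der S Γ (.eq (.app f k₁) (.app f' k₂) (K'.inst k₁))
  | beta {n : ℕ} {Γ : Ctx C n} {K : Kind C n} {k' : Obj C (n + 1)} {K' : Kind C (n + 1)}
      {k : Obj C n}
      (h₁ : Der S (Γ.snoc K) (.ofKind k' K')) (h₂ : Der S Γ (.ofKind k K)) :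
      Der S Γ (.eq (.app (.lam K k') k) (k'.inst k) (K'.inst k))
  | eta {n : ℕ} {Γ : Ctx C n} {f : Obj C n} {K : Kind C n} {K' : Kind C (n + 1)}
      (h : Der S Γ (.ofKind f (.pi K K'))) :
      Der S Γ (.eq (.lam K (.app f.wk (.var 0))) f (.pi K K'))
  -- the declared constants
  | const {n : ℕ} {Γ : Ctx C n} {c : C} {K : Kind C 0} (hc : Decl.const c K ∈ S)
      (hK : Der S .nil (.kind K)) (h : Der S Γ .valid) :
      Der S Γ (.ofKind (.const c) (K.rename Fin.elim0))
  -- the declared computation rules; `σ` is the sequence of objects substituted for `Δ`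
  | comp {n m : ℕ} {Γ : Ctx C n} {Δ : Ctx C m} {k k' : Obj C m} {K : Kind C m} {σ : Sub C m n}
      (he : Decl.eq Δ k k' K ∈ S) (h : Der S Γ .valid)
      (hσ : ∀ i : Fin m, Der S Γ (.ofKind (σ i) ((Δ.lookup i).subst σ)))
      (h₁ : Der S Γ (.ofKind (k.subst σ) (K.subst σ)))
      (h₂ : Der S Γ (.ofKind (k'.subst σ) (K.subst σ))) :
      Der S Γ (.eq (k.subst σ) (k'.subst σ) (K.subst σ))

/-- Derivability of a judgement under a specification. -/
def Derivable (S : Spec C) (J : Judgement C) : Prop := Der S J.ctx J.body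

end

end LF

/-! ### The translation from the lambda-free into the traditional framework -/

namespace TFk

section

variable {C : Type u} {ar : C → Arity}

/-- The position of a variable. -/
def Var.lift {Φ : Scope} {α : Arity} : Var Φ α → Fin Φ.length
  | .zero => (0 : Fin (_ + 1))
  | .succ x => x.lift.succ

/-- What the translation yields on each category: objects and abstractions are mapped to objects,
kinds to kinds, and an abstraction sequence `F₁, …, Fₙ` to the operation
`h ↦ h lift(F₁) ⋯ lift(Fₙ)`. -/
abbrev Lifted (C : Type u) (n : ℕ) : Cat → Type u
  | .obj => LF.Obj C n
  | .args _ => LF.Obj C n → LF.Obj C n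
  | .abs _ => LF.Obj C n
  | .kind _ => LF.Kind C n

/-- The translation of expressions. -/
def Exp.lift {Φ : Scope} {s : Cat} : Exp ar Φ s → Lifted C Φ.length s
  | .var x Fs => Fs.lift (LF.Exp.var x.lift)
  | .const c Fs => Fs.lift (LF.Exp.const c)
  | .nil => fun h => h
  | .cons F Fs => fun h => Fs.lift (LF.Exp.app h F.lift)
  | .body M => M.lift
  | .lam K F => LF.Exp.lam K.lift F.lift
  | .type => LF.Exp.type
  | .el M => LF.Exp.el M.lift
  | .pi K K' => LF.Exp.pi K.lift K'.lift

/-- The translation of contexts. -/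
def Ctx.lift {Φ : Scope} : Ctx ar Φ → LF.Ctx C Φ.length
  | .nil => .nil
  | .snoc Γ K => LF.Ctx.snoc Γ.lift K.lift

/-- The translation of judgements. -/
def Judgement.lift : Judgement ar → LF.Judgement C
  | .valid Γ => ⟨_, Γ.lift, .valid⟩
  | .ofKind Γ M T => ⟨_, Γ.lift, .ofKind M.lift T.lift⟩
  | .eq Γ M N T => ⟨_, Γ.lift, .eq M.lift N.lift T.lift⟩

/-- The translation of declarations. -/
def Decl.lift : Decl ar → LF.Decl C
  | .const c K => .const c K.lift
  | .eq Δ M N T => .eq Δ.lift M.lift N.lift T.lift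

/-- The translation of specifications. -/
def Spec.lift (S : Spec ar) : LF.Spec C := Decl.lift '' S

end

end TFk

/-!
The statement is proved by induction on the derivation in the lambda-free framework. What has to
be compared is hereditary instantiation `{F/x}X` there with ordinary substitution in the
traditional framework: the translation of `{F/x}X` is a `β`-reduct of `[lift(F)/x]lift(X)`, and
the two have to be *judgementally* equal in a Church-typed calculus, where each `β`-step needs the
label of the abstraction to match the kind of the argument.

This match comes from the injectivity of product kinds. As kinds do not compute, a kind
equal to `(x : K)K'` is itself a product with equal components (`LF.PDer.kindEq_pi`). To have this
and the generation lemmas by plain induction, the argument works in a presentation `LF.PDer` of the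
traditional framework that lacks the substitution rules and `η` and has presuppositions as
additional premises. It is contained in `LF.Der` (`LF.PDer.der`), and in it simultaneous
substitution (`LF.PDer.subst`), presuppositions (`LF.PDer.presupposed`) and substitution of equal
objects (`LF.PDer.functional`) are admissible.

The comparison is `TFk.employEq_employ` with `TFk.EmployEq.substEq`, by induction on the arity of
`F` and then on `X`: *if* `lift(X)` is well-formed, then `[lift(F)/x]lift(X)` equals
`lift({F/x}X)`. Only the well-formedness of the translation is assumed, so that no metatheory of the
lambda-free framework is needed.

For a declared equation, the arguments of the equation yield a substitution for its context, and
the abstractions `[Δ]M` and `[Δ]N` applied to them reduce to the substitution instances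
of `M` and `N` (`LF.SpineEq.of_pis`). The rules for declarations require in the
traditional framework that the declarations be well-formed; this is where
orderability is used, by induction along the ordering (`TFk.Spec.Orderable.liftWellFormed`).
-/

namespace LF

/-! ### Substitution in the traditional framework -/

section Substitution

variable {C : Type u}

theorem Sub.up_var {n m : ℕ} (ρ : Fin n → Fin m) :
    Sub.up (fun i => (.var (ρ i) : Obj C m)) = fun i => .var (upRen ρ i) := by
  funext i
  refine Fin.cases rfl (fun j => rfl) i

theorem Exp.rename_eq_subst {n m : ℕ} {s : Cat} (ρ : Fin n → Fin m) (X : Exp C n s) :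
    X.rename ρ = X.subst (fun i => .var (ρ i)) := by
  induction X generalizing m with
  | type | var | const => rfl
  | el k ih => simp only [rename, subst, ih]
  | pi K K' ih ih' => simp only [rename, subst, ih, ih', Sub.up_var]
  | lam K k ih ih' => simp only [rename, subst, ih, ih', Sub.up_var]
  | app k k' ih ih' => simp only [rename, subst, ih, ih']

theorem Exp.subst_var {n : ℕ} {s : Cat} (X : Exp C n s) : X.subst .var = X := by
  have up_var {n : ℕ} : Sub.up (.var : Sub C n n) = .var := by
    funext i
    refine Fin.cases rfl (fun j => rfl) i
  induction X with
  | type | var | const => rfl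
  | el k ih => simp only [subst, ih]
  | pi K K' ih ih' => simp only [subst, ih, ih', up_var]
  | lam K k ih ih' => simp only [subst, ih, ih', up_var]
  | app k k' ih ih' => simp only [subst, ih, ih']

theorem Exp.subst_rename {n m l : ℕ} {s : Cat} (ρ : Fin n → Fin m) (τ : Sub C m l)
    (X : Exp C n s) : (X.rename ρ).subst τ = X.subst (fun i => τ (ρ i)) := by
  have up_comp {n m l : ℕ} (ρ : Fin n → Fin m) (τ : Sub C m l) :
      (fun i => τ.up (upRen ρ i)) = Sub.up (fun i => τ (ρ i)) := by
    funext i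
    refine Fin.cases rfl (fun j => rfl) i
  induction X generalizing m l with
  | type | var | const => rfl
  | el k ih => simp only [rename, subst, ih]
  | pi K K' ih ih' => simp only [rename, subst, ih, ih', up_comp]
  | lam K k ih ih' => simp only [rename, subst, ih, ih', up_comp]
  | app k k' ih ih' => simp only [rename, subst, ih, ih']

theorem Exp.rename_rename {n m l : ℕ} {s : Cat} (ρ : Fin n → Fin m) (ρ' : Fin m → Fin l)
    (X : Exp C n s) : (X.rename ρ).rename ρ' = X.rename (fun i => ρ' (ρ i)) := by
  rw [rename_eq_subst ρ', subst_rename, rename_eq_subst]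

theorem Exp.rename_subst {n m l : ℕ} {s : Cat} (σ : Sub C n m) (ρ : Fin m → Fin l)
    (X : Exp C n s) : (X.subst σ).rename ρ = X.subst (fun i => (σ i).rename ρ) := by
  have up_comp {n m l : ℕ} (σ : Sub C n m) (ρ : Fin m → Fin l) :
      (fun i => (σ.up i).rename (upRen ρ)) = Sub.up (fun i => (σ i).rename ρ) := by
    funext i
    refine Fin.cases rfl (fun j => ?_) i
    change ((σ j).rename Fin.succ).rename _ = ((σ j).rename ρ).rename Fin.succ
    rw [rename_rename, rename_rename]
    rfl
  induction X generalizing m l with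
  | type | var | const => rfl
  | el k ih => simp only [rename, subst, ih]
  | pi K K' ih ih' => simp only [rename, subst, ih, ih', up_comp]
  | lam K k ih ih' => simp only [rename, subst, ih, ih', up_comp]
  | app k k' ih ih' => simp only [rename, subst, ih, ih']

theorem Exp.subst_subst {n m l : ℕ} {s : Cat} (σ : Sub C n m) (τ : Sub C m l)
    (X : Exp C n s) : (X.subst σ).subst τ = X.subst (fun i => (σ i).subst τ) := by
  have up_comp {n m l : ℕ} (σ : Sub C n m) (τ : Sub C m l) :
      (fun i => (σ.up i).subst τ.up) = Sub.up (fun i => (σ i).subst τ) := by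
    funext i
    refine Fin.cases rfl (fun j => ?_) i
    change ((σ j).rename Fin.succ).subst _ = ((σ j).subst τ).rename Fin.succ
    rw [subst_rename, rename_subst]
    rfl
  induction X generalizing m l with
  | type | var | const => rfl
  | el k ih => simp only [subst, ih]
  | pi K K' ih ih' => simp only [subst, ih, ih', up_comp]
  | lam K k ih ih' => simp only [subst, ih, ih', up_comp]
  | app k k' ih ih' => simp only [subst, ih, ih']

/-- Extend a substitution by an object for one further variable. -/
def Sub.cons {n m : ℕ} (σ : Sub C n m) (k : Obj C m) : Sub C (n + 1) m := Fin.cases k σ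

theorem Exp.wk_subst_cons {n m : ℕ} {s : Cat} (σ : Sub C n m) (k : Obj C m) (X : Exp C n s) :
    X.wk.subst (σ.cons k) = X.subst σ :=
  subst_rename _ _ _

theorem Exp.wk_subst_single {n : ℕ} {s : Cat} (k : Obj C n) (X : Exp C n s) :
    X.wk.subst (single k) = X :=
  (subst_rename _ _ _).trans (subst_var X)

theorem Exp.wk_subst_up {n m : ℕ} {s : Cat} (σ : Sub C n m) (X : Exp C n s) :
    X.wk.subst σ.up = (X.subst σ).wk := by
  rw [wk, wk, subst_rename, rename_subst]
  rfl

theorem Exp.subst_up_inst {n m : ℕ} {s : Cat} (σ : Sub C n m) (k : Obj C m)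
    (X : Exp C (n + 1) s) : (X.subst σ.up).inst k = X.subst (σ.cons k) := by
  rw [inst, subst_subst]
  congr 1
  funext i
  refine Fin.cases rfl (fun j => ?_) i
  exact wk_subst_single k (σ j)

theorem Exp.inst_subst {n m : ℕ} {s : Cat} (σ : Sub C n m) (k : Obj C n)
    (X : Exp C (n + 1) s) : (X.inst k).subst σ = (X.subst σ.up).inst (k.subst σ) := by
  rw [subst_up_inst, inst, subst_subst]
  congr 1
  funext i
  refine Fin.cases rfl (fun j => rfl) i

theorem Exp.closed_subst {n m : ℕ} {s : Cat} (σ : Sub C n m) (X : Exp C 0 s) :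
    (X.rename Fin.elim0).subst σ = X.rename Fin.elim0 := by
  rw [subst_rename, rename_eq_subst]
  congr 1
  funext i
  exact i.elim0

end Substitution

/-! ### A presuppositional presentation of the traditional framework -/

/-- A presentation of the traditional framework without the substitution rules and `η`, in which
the rules carry additional premises: kinds that are bound or applied are well-formed, and in
`app_eq` the two result kinds are equal. Without those premises, its rules are rules of `LF.Der`.
Substitution is admissible, and generation lemmas hold since a derivation of a typing judgement
ends in the rule for the object in question or in `conv`. -/
inductive PDer {C : Type u} (S : Spec C) : {n : ℕ} → Ctx C n → Body C n → Prop
  | emp : PDer S .nil .valid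
  | ctxt {n : ℕ} {Γ : Ctx C n} {K : Kind C n} (h : PDer S Γ (.kind K)) :
      PDer S (Γ.snoc K) .valid
  | var {n : ℕ} {Γ : Ctx C n} (i : Fin n) (h : PDer S Γ .valid) :
      PDer S Γ (.ofKind (.var i) (Γ.lookup i))
  | kind_refl {n : ℕ} {Γ : Ctx C n} {K : Kind C n} (h : PDer S Γ (.kind K)) :
      PDer S Γ (.kindEq K K)
  | kind_symm {n : ℕ} {Γ : Ctx C n} {K K' : Kind C n} (h : PDer S Γ (.kindEq K K')) :
      PDer S Γ (.kindEq K' K)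
  | kind_trans {n : ℕ} {Γ : Ctx C n} {K K' K'' : Kind C n} (h₁ : PDer S Γ (.kindEq K K'))
      (h₂ : PDer S Γ (.kindEq K' K'')) : PDer S Γ (.kindEq K K'')
  | refl {n : ℕ} {Γ : Ctx C n} {k : Obj C n} {K : Kind C n} (h : PDer S Γ (.ofKind k K)) :
      PDer S Γ (.eq k k K)
  | symm {n : ℕ} {Γ : Ctx C n} {k k' : Obj C n} {K : Kind C n} (h : PDer S Γ (.eq k k' K)) :
      PDer S Γ (.eq k' k K)
  | trans {n : ℕ} {Γ : Ctx C n} {k k' k'' : Obj C n} {K : Kind C n}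
      (h₁ : PDer S Γ (.eq k k' K)) (h₂ : PDer S Γ (.eq k' k'' K)) : PDer S Γ (.eq k k'' K)
  | conv {n : ℕ} {Γ : Ctx C n} {k : Obj C n} {K K' : Kind C n} (h₁ : PDer S Γ (.ofKind k K))
      (h₂ : PDer S Γ (.kindEq K K')) : PDer S Γ (.ofKind k K')
  | conv_eq {n : ℕ} {Γ : Ctx C n} {k k' : Obj C n} {K K' : Kind C n}
      (h₁ : PDer S Γ (.eq k k' K)) (h₂ : PDer S Γ (.kindEq K K')) : PDer S Γ (.eq k k' K')
  | type {n : ℕ} {Γ : Ctx C n} (h : PDer S Γ .valid) : PDer S Γ (.kind .type)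
  | el {n : ℕ} {Γ : Ctx C n} {A : Obj C n} (h : PDer S Γ (.ofKind A .type)) :
      PDer S Γ (.kind (.el A))
  | el_eq {n : ℕ} {Γ : Ctx C n} {A B : Obj C n} (h : PDer S Γ (.eq A B .type)) :
      PDer S Γ (.kindEq (.el A) (.el B))
  | pi {n : ℕ} {Γ : Ctx C n} {K : Kind C n} {K' : Kind C (n + 1)} (h₁ : PDer S Γ (.kind K))
      (h₂ : PDer S (Γ.snoc K) (.kind K')) : PDer S Γ (.kind (.pi K K'))
  | pi_eq {n : ℕ} {Γ : Ctx C n} {K₁ K₂ : Kind C n} {K₁' K₂' : Kind C (n + 1)}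
      (h₀ : PDer S Γ (.kind K₁)) (h₁ : PDer S Γ (.kindEq K₁ K₂))
      (h₂ : PDer S (Γ.snoc K₁) (.kindEq K₁' K₂')) :
      PDer S Γ (.kindEq (.pi K₁ K₁') (.pi K₂ K₂'))
  | lam {n : ℕ} {Γ : Ctx C n} {K : Kind C n} {k : Obj C (n + 1)} {K' : Kind C (n + 1)}
      (h₀ : PDer S Γ (.kind K)) (h : PDer S (Γ.snoc K) (.ofKind k K')) :
      PDer S Γ (.ofKind (.lam K k) (.pi K K'))
  | lam_eq {n : ℕ} {Γ : Ctx C n} {K₁ K₂ : Kind C n} {k₁ k₂ : Obj C (n + 1)}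
      {K' : Kind C (n + 1)} (h₀ : PDer S Γ (.kind K₁))
      (h₁ : PDer S Γ (.kindEq K₁ K₂)) (h₂ : PDer S (Γ.snoc K₁) (.eq k₁ k₂ K')) :
      PDer S Γ (.eq (.lam K₁ k₁) (.lam K₂ k₂) (.pi K₁ K'))
  | app {n : ℕ} {Γ : Ctx C n} {f k : Obj C n} {K : Kind C n} {K' : Kind C (n + 1)}
      (h₀ : PDer S Γ (.kind K)) (h₀' : PDer S (Γ.snoc K) (.kind K'))
      (h₁ : PDer S Γ (.ofKind f (.pi K K'))) (h₂ : PDer S Γ (.ofKind k K)) :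
      PDer S Γ (.ofKind (.app f k) (K'.inst k))
  | app_eq {n : ℕ} {Γ : Ctx C n} {f f' k₁ k₂ : Obj C n} {K : Kind C n} {K' : Kind C (n + 1)}
      (h₀ : PDer S Γ (.kindEq (K'.inst k₁) (K'.inst k₂)))
      (h₁ : PDer S Γ (.eq f f' (.pi K K'))) (h₂ : PDer S Γ (.eq k₁ k₂ K)) :
      PDer S Γ (.eq (.app f k₁) (.app f' k₂) (K'.inst k₁))
  | beta {n : ℕ} {Γ : Ctx C n} {K : Kind C n} {k' : Obj C (n + 1)} {K' : Kind C (n + 1)}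
      {k : Obj C n} (h₀ : PDer S Γ (.kind K))
      (h₁ : PDer S (Γ.snoc K) (.ofKind k' K')) (h₂ : PDer S Γ (.ofKind k K)) :
      PDer S Γ (.eq (.app (.lam K k') k) (k'.inst k) (K'.inst k))
  | const {n : ℕ} {Γ : Ctx C n} {c : C} {K : Kind C 0} (hc : Decl.const c K ∈ S)
      (hK : PDer S .nil (.kind K)) (h : PDer S Γ .valid) :
      PDer S Γ (.ofKind (.const c) (K.rename Fin.elim0))
  | comp {n m : ℕ} {Γ : Ctx C n} {Δ : Ctx C m} {k k' : Obj C m} {K : Kind C m} {σ : Sub C m n}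
      (he : Decl.eq Δ k k' K ∈ S) (h : PDer S Γ .valid)
      (hσ : ∀ i : Fin m, PDer S Γ (.ofKind (σ i) ((Δ.lookup i).subst σ)))
      (h₁ : PDer S Γ (.ofKind (k.subst σ) (K.subst σ)))
      (h₂ : PDer S Γ (.ofKind (k'.subst σ) (K.subst σ))) :
      PDer S Γ (.eq (k.subst σ) (k'.subst σ) (K.subst σ))

section Metatheory

variable {C : Type u} {S : Spec C}

theorem PDer.der {n : ℕ} {Γ : Ctx C n} {J : Body C n} (h : PDer S Γ J) : Der S Γ J := by
  induction h with
  | emp => exact .emp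
  | ctxt _ ih => exact .ctxt ih
  | var i _ ih => exact .var i ih
  | kind_refl _ ih => exact .kind_refl ih
  | kind_symm _ ih => exact .kind_symm ih
  | kind_trans _ _ ih₁ ih₂ => exact .kind_trans ih₁ ih₂
  | refl _ ih => exact .refl ih
  | symm _ ih => exact .symm ih
  | trans _ _ ih₁ ih₂ => exact .trans ih₁ ih₂
  | conv _ _ ih₁ ih₂ => exact .conv ih₁ ih₂
  | conv_eq _ _ ih₁ ih₂ => exact .conv_eq ih₁ ih₂
  | type _ ih => exact .type ih
  | el _ ih => exact .el ih
  | el_eq _ ih => exact .el_eq ih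
  | pi _ _ ih₁ ih₂ => exact .pi ih₁ ih₂
  | pi_eq _ _ _ _ ih₁ ih₂ => exact .pi_eq ih₁ ih₂
  | lam _ _ _ ih => exact .lam ih
  | lam_eq _ _ _ _ ih₁ ih₂ => exact .lam_eq ih₁ ih₂
  | app _ _ _ _ _ _ ih₁ ih₂ => exact .app ih₁ ih₂
  | app_eq _ _ _ _ ih₁ ih₂ => exact .app_eq ih₁ ih₂
  | beta _ _ _ _ ih₁ ih₂ => exact .beta ih₁ ih₂
  | const hc _ _ ih₁ ih₂ => exact .const hc ih₁ ih₂
  | comp he _ _ _ _ ih ihσ ih₁ ih₂ => exact .comp he ih ihσ ih₁ ih₂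

theorem PDer.valid {n : ℕ} {Γ : Ctx C n} {J : Body C n} (h : PDer S Γ J) :
    PDer S Γ .valid := by
  induction h with
  | emp => exact .emp
  | ctxt h _ => exact .ctxt h
  | _ => assumption

/-- A class of substitutions between contexts that is closed under passing below a binder and
whose members consist of objects of the right kinds preserves derivability. It is used twice:
first for renamings, then, with their weakening available, for all typed substitutions. -/
theorem PDer.subst_of_closed (R : ∀ {n m : ℕ}, Ctx C n → Ctx C m → Sub C n m → Prop)
    (ofKind : ∀ {n m : ℕ} {Γ : Ctx C n} {Γ' : Ctx C m} {σ : Sub C n m}, R Γ Γ' σ →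
      PDer S Γ' .valid → ∀ i, PDer S Γ' (.ofKind (σ i) ((Γ.lookup i).subst σ)))
    (up : ∀ {n m : ℕ} {Γ : Ctx C n} {Γ' : Ctx C m} {σ : Sub C n m} {K : Kind C n}, R Γ Γ' σ →
      PDer S Γ' (.kind (K.subst σ)) → R (Γ.snoc K) (Γ'.snoc (K.subst σ)) σ.up)
    {n m : ℕ} {Γ : Ctx C n} {Γ' : Ctx C m} {σ : Sub C n m} {J : Body C n} (h : PDer S Γ J)
    (hσ : R Γ Γ' σ) (hΓ' : PDer S Γ' .valid) : PDer S Γ' (J.subst σ) := by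
  induction h generalizing m with
  | emp | ctxt => exact hΓ'
  | var i _ _ => exact ofKind hσ hΓ' i
  | kind_refl _ ih => exact .kind_refl (ih hσ hΓ')
  | kind_symm _ ih => exact .kind_symm (ih hσ hΓ')
  | kind_trans _ _ ih₁ ih₂ => exact .kind_trans (ih₁ hσ hΓ') (ih₂ hσ hΓ')
  | refl _ ih => exact .refl (ih hσ hΓ')
  | symm _ ih => exact .symm (ih hσ hΓ')
  | trans _ _ ih₁ ih₂ => exact .trans (ih₁ hσ hΓ') (ih₂ hσ hΓ')
  | conv _ _ ih₁ ih₂ => exact .conv (ih₁ hσ hΓ') (ih₂ hσ hΓ')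
  | conv_eq _ _ ih₁ ih₂ => exact .conv_eq (ih₁ hσ hΓ') (ih₂ hσ hΓ')
  | type _ _ => exact .type hΓ'
  | el _ ih => exact .el (ih hσ hΓ')
  | el_eq _ ih => exact .el_eq (ih hσ hΓ')
  | pi _ _ ih₁ ih₂ =>
      have hK := ih₁ hσ hΓ'
      exact .pi hK (ih₂ (up hσ hK) (.ctxt hK))
  | pi_eq _ _ _ ih₀ ih₁ ih₂ =>
      have hK := ih₀ hσ hΓ'
      exact .pi_eq hK (ih₁ hσ hΓ') (ih₂ (up hσ hK) (.ctxt hK))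
  | lam _ _ ih₀ ih =>
      have hK := ih₀ hσ hΓ'
      exact .lam hK (ih (up hσ hK) (.ctxt hK))
  | lam_eq _ _ _ ih₀ ih₁ ih₂ =>
      have hK := ih₀ hσ hΓ'
      exact .lam_eq hK (ih₁ hσ hΓ') (ih₂ (up hσ hK) (.ctxt hK))
  | app _ _ _ _ ih₀ ih₀' ih₁ ih₂ =>
      have hK := ih₀ hσ hΓ'
      simp only [Body.subst, Exp.inst_subst]
      exact .app hK (ih₀' (up hσ hK) (.ctxt hK)) (ih₁ hσ hΓ') (ih₂ hσ hΓ')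
  | app_eq _ _ _ ih₀ ih₁ ih₂ =>
      have hK := ih₀ hσ hΓ'
      simp only [Body.subst, Exp.inst_subst] at hK ⊢
      exact .app_eq hK (ih₁ hσ hΓ') (ih₂ hσ hΓ')
  | beta _ _ _ ih₀ ih₁ ih₂ =>
      have hK := ih₀ hσ hΓ'
      simp only [Body.subst, Exp.inst_subst]
      exact .beta hK (ih₁ (up hσ hK) (.ctxt hK)) (ih₂ hσ hΓ')
  | const hc hK _ _ _ =>
      simp only [Body.subst, Exp.closed_subst]
      exact .const hc hK hΓ'
  | comp he _ _ _ _ _ ihσ ih₁ ih₂ =>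
      have h₁ := ih₁ hσ hΓ'
      have h₂ := ih₂ hσ hΓ'
      simp only [Body.subst, Exp.subst_subst] at h₁ h₂ ⊢
      refine .comp he hΓ' (fun i => ?_) h₁ h₂
      have hi := ihσ i hσ hΓ'
      simp only [Body.subst, Exp.subst_subst] at hi
      exact hi

theorem PDer.rename {n m : ℕ} {Γ : Ctx C n} {Γ' : Ctx C m} {ρ : Fin n → Fin m} {J : Body C n}
    (h : PDer S Γ J) (hρ : ∀ i, Γ'.lookup (ρ i) = (Γ.lookup i).rename ρ)
    (hΓ' : PDer S Γ' .valid) : PDer S Γ' (J.subst fun i => .var (ρ i)) := by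
  refine h.subst_of_closed (Γ' := Γ') (σ := fun i => .var (ρ i))
    (R := fun {n m} Γ Γ' σ => ∃ ρ : Fin n → Fin m, (σ = fun i => .var (ρ i)) ∧
      ∀ i, Γ'.lookup (ρ i) = (Γ.lookup i).rename ρ) ?_ ?_ ⟨ρ, rfl, hρ⟩ hΓ'
  · rintro n m Γ Γ' _ ⟨ρ, rfl, hρ⟩ hΓ' i
    rw [← Exp.rename_eq_subst, ← hρ]
    exact .var _ hΓ'
  · rintro n m Γ Γ' _ K ⟨ρ, rfl, hρ⟩ _
    refine ⟨upRen ρ, Sub.up_var ρ, fun i => ?_⟩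
    rw [← Exp.rename_eq_subst]
    refine Fin.cases ?_ (fun j => ?_) i
    · change (K.rename ρ).rename Fin.succ = (K.rename Fin.succ).rename _
      rw [Exp.rename_rename, Exp.rename_rename]
      rfl
    · change (Γ'.lookup (ρ j)).rename Fin.succ = ((Γ.lookup j).rename Fin.succ).rename _
      rw [hρ, Exp.rename_rename, Exp.rename_rename]
      rfl

theorem PDer.wk_kind {n : ℕ} {Γ : Ctx C n} {K J : Kind C n} (h : PDer S Γ (.kind J))
    (hK : PDer S Γ (.kind K)) : PDer S (Γ.snoc K) (.kind J.wk) := by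
  have := h.rename (Γ' := Γ.snoc K) (ρ := Fin.succ) (fun _ => rfl) (.ctxt hK)
  simp only [Body.subst, ← Exp.rename_eq_subst] at this
  exact this

theorem PDer.wk_ofKind {n : ℕ} {Γ : Ctx C n} {K J : Kind C n} {k : Obj C n}
    (h : PDer S Γ (.ofKind k J)) (hK : PDer S Γ (.kind K)) :
    PDer S (Γ.snoc K) (.ofKind k.wk J.wk) := by
  have := h.rename (Γ' := Γ.snoc K) (ρ := Fin.succ) (fun _ => rfl) (.ctxt hK)
  simp only [Body.subst, ← Exp.rename_eq_subst] at this
  exact this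

theorem PDer.wk_eq {n : ℕ} {Γ : Ctx C n} {K J : Kind C n} {k k' : Obj C n}
    (h : PDer S Γ (.eq k k' J)) (hK : PDer S Γ (.kind K)) :
    PDer S (Γ.snoc K) (.eq k.wk k'.wk J.wk) := by
  have := h.rename (Γ' := Γ.snoc K) (ρ := Fin.succ) (fun _ => rfl) (.ctxt hK)
  simp only [Body.subst, ← Exp.rename_eq_subst] at this
  exact this

theorem PDer.wk_kindEq {n : ℕ} {Γ : Ctx C n} {K J J' : Kind C n}
    (h : PDer S Γ (.kindEq J J')) (hK : PDer S Γ (.kind K)) :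
    PDer S (Γ.snoc K) (.kindEq J.wk J'.wk) := by
  have := h.rename (Γ' := Γ.snoc K) (ρ := Fin.succ) (fun _ => rfl) (.ctxt hK)
  simp only [Body.subst, ← Exp.rename_eq_subst] at this
  exact this

/-- The substitution `σ` replaces the variables of `Γ` by objects over `Γ'` of the kinds that `Γ`
prescribes. -/
def Typed (S : Spec C) {n m : ℕ} (Γ : Ctx C n) (Γ' : Ctx C m) (σ : Sub C n m) : Prop :=
  ∀ i, PDer S Γ' (.ofKind (σ i) ((Γ.lookup i).subst σ))

theorem Typed.cons {n m : ℕ} {Γ : Ctx C n} {Γ' : Ctx C m} {σ : Sub C n m} {K : Kind C n}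
    {k : Obj C m} (hσ : Typed S Γ Γ' σ) (hk : PDer S Γ' (.ofKind k (K.subst σ))) :
    Typed S (Γ.snoc K) Γ' (σ.cons k) := by
  refine Fin.cases ?_ (fun j => ?_)
  · exact (Exp.wk_subst_cons σ k K).symm ▸ hk
  · exact (Exp.wk_subst_cons σ k (Γ.lookup j)).symm ▸ hσ j

theorem Typed.wk {n m : ℕ} {Γ : Ctx C n} {Γ' : Ctx C m} {σ : Sub C n m} {K : Kind C m}
    (hσ : Typed S Γ Γ' σ) (hK : PDer S Γ' (.kind K)) :
    Typed S Γ (Γ'.snoc K) (fun i => (σ i).wk) := by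
  intro i
  have := (hσ i).wk_ofKind hK
  rwa [Exp.wk, Exp.wk, Exp.rename_subst] at this

/-- Below a binder the kind `J` of the new variable may differ from `K.subst σ` up to equality. -/
theorem Typed.up_of_kindEq {n m : ℕ} {Γ : Ctx C n} {Γ' : Ctx C m} {σ : Sub C n m}
    {K : Kind C n} {J : Kind C m} (hσ : Typed S Γ Γ' σ) (hJ : PDer S Γ' (.kind J))
    (h : PDer S Γ' (.kindEq J (K.subst σ))) : Typed S (Γ.snoc K) (Γ'.snoc J) σ.up := by
  refine (hσ.wk hJ).cons ?_
  have := PDer.conv (.var 0 (.ctxt hJ)) (h.wk_kindEq hJ)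
  rwa [Exp.wk, Exp.rename_subst] at this

theorem Typed.up {n m : ℕ} {Γ : Ctx C n} {Γ' : Ctx C m} {σ : Sub C n m} {K : Kind C n}
    (hσ : Typed S Γ Γ' σ) (hK : PDer S Γ' (.kind (K.subst σ))) :
    Typed S (Γ.snoc K) (Γ'.snoc (K.subst σ)) σ.up :=
  hσ.up_of_kindEq hK (.kind_refl hK)

/-- Simultaneous substitution is admissible. -/
theorem PDer.subst {n m : ℕ} {Γ : Ctx C n} {Γ' : Ctx C m} {σ : Sub C n m} {J : Body C n}
    (h : PDer S Γ J) (hσ : Typed S Γ Γ' σ) (hΓ' : PDer S Γ' .valid) : PDer S Γ' (J.subst σ) :=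
  h.subst_of_closed (R := fun Γ Γ' σ => Typed S Γ Γ' σ) (fun hσ _ => hσ)
    (fun hσ hK => hσ.up hK) hσ hΓ'

theorem Typed.var {n : ℕ} {Γ : Ctx C n} (hΓ : PDer S Γ .valid) : Typed S Γ Γ .var := by
  intro i
  rw [Exp.subst_var]
  exact .var i hΓ

theorem Typed.single {n : ℕ} {Γ : Ctx C n} {K : Kind C n} {k : Obj C n}
    (hk : PDer S Γ (.ofKind k K)) : Typed S (Γ.snoc K) Γ (single k) :=
  (Typed.var hk.valid).cons (by rwa [Exp.subst_var])

theorem PDer.inst {n : ℕ} {Γ : Ctx C n} {K : Kind C n} {k : Obj C n} {J : Body C (n + 1)}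
    (h : PDer S (Γ.snoc K) J) (hk : PDer S Γ (.ofKind k K)) :
    PDer S Γ (J.subst (LF.single k)) :=
  h.subst (.single hk) hk.valid

theorem Body.subst_var {n : ℕ} (J : Body C n) : J.subst .var = J := by
  cases J <;> simp only [subst, Exp.subst_var]

/-- Context conversion. -/
theorem PDer.snoc_conv {n : ℕ} {Γ : Ctx C n} {K K' : Kind C n} {J : Body C (n + 1)}
    (h : PDer S (Γ.snoc K) J) (hK' : PDer S Γ (.kind K')) (e : PDer S Γ (.kindEq K' K)) :
    PDer S (Γ.snoc K') J := by
  have up_var : Sub.up (.var : Sub C n n) = .var := by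
    funext i
    refine Fin.cases rfl (fun j => rfl) i
  have hv : Typed S (Γ.snoc K) (Γ.snoc K') (Sub.up .var) :=
    (Typed.var hK'.valid).up_of_kindEq hK' (by rwa [Exp.subst_var])
  have := h.subst hv (.ctxt hK')
  rwa [up_var, Body.subst_var] at this

/-! ### Presuppositions and generation -/

theorem PDer.lookup {n : ℕ} {Γ : Ctx C n} (h : PDer S Γ .valid) (i : Fin n) :
    PDer S Γ (.kind (Γ.lookup i)) := by
  induction Γ with
  | nil => exact i.elim0
  | snoc Γ K ih =>
      cases h with
      | ctxt h => exact Fin.cases (h.wk_kind h) (fun j => (ih h.valid j).wk_kind h) i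

theorem PDer.pi_inv {n : ℕ} {Γ : Ctx C n} {K : Kind C n} {K' : Kind C (n + 1)}
    (h : PDer S Γ (.kind (.pi K K'))) :
    PDer S Γ (.kind K) ∧ PDer S (Γ.snoc K) (.kind K') := by
  cases h with
  | pi h₁ h₂ => exact ⟨h₁, h₂⟩

theorem PDer.el_inv {n : ℕ} {Γ : Ctx C n} {A : Obj C n} (h : PDer S Γ (.kind (.el A))) :
    PDer S Γ (.ofKind A .type) := by
  cases h with
  | el h => exact h

/-- The presuppositions of a judgement: the kinds it mentions are well-formed and the objects it
equates have the kind in question. -/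
def Body.Presupposed (S : Spec C) {n : ℕ} (Γ : Ctx C n) : Body C n → Prop
  | .valid => True
  | .kind _ => True
  | .ofKind _ K => PDer S Γ (.kind K)
  | .eq k k' K => PDer S Γ (.ofKind k K) ∧ PDer S Γ (.ofKind k' K) ∧ PDer S Γ (.kind K)
  | .kindEq K K' => PDer S Γ (.kind K) ∧ PDer S Γ (.kind K')

theorem PDer.presupposed {n : ℕ} {Γ : Ctx C n} {J : Body C n} (h : PDer S Γ J) :
    J.Presupposed S Γ := by
  induction h with
  | emp | ctxt | type | el | pi => trivial
  | var i h _ => exact h.lookup i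
  | kind_refl h _ => exact ⟨h, h⟩
  | kind_symm _ ih => exact ⟨ih.2, ih.1⟩
  | kind_trans _ _ ih₁ ih₂ => exact ⟨ih₁.1, ih₂.2⟩
  | refl h ih => exact ⟨h, h, ih⟩
  | symm _ ih => exact ⟨ih.2.1, ih.1, ih.2.2⟩
  | trans _ _ ih₁ ih₂ => exact ⟨ih₁.1, ih₂.2.1, ih₁.2.2⟩
  | conv _ _ _ ih₂ => exact ih₂.2
  | conv_eq _ h₂ ih₁ ih₂ => exact ⟨.conv ih₁.1 h₂, .conv ih₁.2.1 h₂, ih₂.2⟩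
  | el_eq _ ih => exact ⟨.el ih.1, .el ih.2.1⟩
  | pi_eq h₀ h₁ h₂ _ ih₁ ih₂ =>
      exact ⟨.pi h₀ ih₂.1, .pi ih₁.2 (ih₂.2.snoc_conv ih₁.2 (.kind_symm h₁))⟩
  | lam h₀ _ _ ih => exact .pi h₀ ih
  | lam_eq h₀ h₁ h₂ _ ih₁ ih₂ =>
      have h₁' := PDer.kind_symm h₁
      have hK' := ih₂.2.2.snoc_conv ih₁.2 h₁'
      exact ⟨.lam h₀ ih₂.1,
        .conv (.lam ih₁.2 (ih₂.2.1.snoc_conv ih₁.2 h₁')) (.pi_eq ih₁.2 h₁' (.kind_refl hK')),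
        .pi h₀ ih₂.2.2⟩
  | app _ h₀' _ h₂ _ _ _ _ => exact h₀'.inst h₂
  | app_eq h₀ _ _ ih₀ ih₁ ih₂ =>
      have h := ih₁.2.2.pi_inv
      exact ⟨.app h.1 h.2 ih₁.1 ih₂.1, .conv (.app h.1 h.2 ih₁.2.1 ih₂.2.1) (.kind_symm h₀),
        ih₀.1⟩
  | beta h₀ h₁ h₂ _ ih₁ _ =>
      exact ⟨.app h₀ ih₁ (.lam h₀ h₁) h₂, h₁.inst h₂, ih₁.inst h₂⟩
  | const _ hK h _ _ =>
      have := hK.rename (ρ := Fin.elim0) (fun i => i.elim0) h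
      simp only [Body.subst, ← Exp.rename_eq_subst] at this
      exact this
  | comp _ _ _ h₁ h₂ _ _ ih₁ _ => exact ⟨h₁, h₂, ih₁⟩

theorem PDer.kind_of_ofKind {n : ℕ} {Γ : Ctx C n} {k : Obj C n} {K : Kind C n}
    (h : PDer S Γ (.ofKind k K)) : PDer S Γ (.kind K) :=
  h.presupposed

theorem PDer.eq_left {n : ℕ} {Γ : Ctx C n} {k k' : Obj C n} {K : Kind C n}
    (h : PDer S Γ (.eq k k' K)) : PDer S Γ (.ofKind k K) :=
  h.presupposed.1

theorem PDer.eq_right {n : ℕ} {Γ : Ctx C n} {k k' : Obj C n} {K : Kind C n}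
    (h : PDer S Γ (.eq k k' K)) : PDer S Γ (.ofKind k' K) :=
  h.presupposed.2.1

theorem PDer.kindEq_left {n : ℕ} {Γ : Ctx C n} {K K' : Kind C n}
    (h : PDer S Γ (.kindEq K K')) : PDer S Γ (.kind K) :=
  h.presupposed.1

theorem PDer.kindEq_right {n : ℕ} {Γ : Ctx C n} {K K' : Kind C n}
    (h : PDer S Γ (.kindEq K K')) : PDer S Γ (.kind K') :=
  h.presupposed.2

theorem PDer.snoc_inv {n : ℕ} {Γ : Ctx C n} {K : Kind C n} {J : Body C (n + 1)}
    (h : PDer S (Γ.snoc K) J) : PDer S Γ (.kind K) := by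
  cases h.valid with
  | ctxt h => exact h

theorem PDer.pi_eq' {n : ℕ} {Γ : Ctx C n} {K₁ K₂ : Kind C n} {K₁' K₂' : Kind C (n + 1)}
    (h₁ : PDer S Γ (.kindEq K₁ K₂)) (h₂ : PDer S (Γ.snoc K₁) (.kindEq K₁' K₂')) :
    PDer S Γ (.kindEq (.pi K₁ K₁') (.pi K₂ K₂')) :=
  .pi_eq h₁.kindEq_left h₁ h₂

theorem PDer.lam_eq' {n : ℕ} {Γ : Ctx C n} {K₁ K₂ : Kind C n} {k₁ k₂ : Obj C (n + 1)}
    {K' : Kind C (n + 1)} (h₁ : PDer S Γ (.kindEq K₁ K₂))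
    (h₂ : PDer S (Γ.snoc K₁) (.eq k₁ k₂ K')) :
    PDer S Γ (.eq (.lam K₁ k₁) (.lam K₂ k₂) (.pi K₁ K')) :=
  .lam_eq h₁.kindEq_left h₁ h₂

/-- Kinds do not compute, so a kind equal to a product is a product with equal components. -/
theorem PDer.kindEq_pi {n : ℕ} {Γ : Ctx C n} {K K' : Kind C n} (h : PDer S Γ (.kindEq K K')) :
    (∀ A B, K = .pi A B → ∃ A' B', K' = .pi A' B' ∧ PDer S Γ (.kindEq A A') ∧
      PDer S (Γ.snoc A) (.kindEq B B')) ∧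
    (∀ A B, K' = .pi A B → ∃ A' B', K = .pi A' B' ∧ PDer S Γ (.kindEq A A') ∧
      PDer S (Γ.snoc A) (.kindEq B B')) := by
  generalize hJ : Body.kindEq K K' = J at h
  induction h with
  | kind_refl h _ =>
      cases hJ
      refine ⟨?_, ?_⟩ <;>
      · rintro A B rfl
        exact ⟨A, B, rfl, .kind_refl h.pi_inv.1, .kind_refl h.pi_inv.2⟩
  | kind_symm _ ih =>
      cases hJ
      exact ⟨(ih rfl).2, (ih rfl).1⟩
  | kind_trans _ _ ih₁ ih₂ =>
      cases hJ
      refine ⟨?_, ?_⟩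
      · intro A B e
        obtain ⟨A', B', e', hA, hB⟩ := (ih₁ rfl).1 A B e
        obtain ⟨A'', B'', e'', hA', hB'⟩ := (ih₂ rfl).1 A' B' e'
        exact ⟨A'', B'', e'', .kind_trans hA hA', .kind_trans hB (hB'.snoc_conv hA.kindEq_left hA)⟩
      · intro A B e
        obtain ⟨A', B', e', hA, hB⟩ := (ih₂ rfl).2 A B e
        obtain ⟨A'', B'', e'', hA', hB'⟩ := (ih₁ rfl).2 A' B' e'
        exact ⟨A'', B'', e'', .kind_trans hA hA', .kind_trans hB (hB'.snoc_conv hA.kindEq_left hA)⟩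
  | el_eq _ _ =>
      cases hJ
      exact ⟨fun _ _ e => (nomatch e), fun _ _ e => (nomatch e)⟩
  | pi_eq h₀ h₁ h₂ _ _ _ =>
      cases hJ
      refine ⟨?_, ?_⟩
      · rintro A B e
        cases e
        exact ⟨_, _, rfl, h₁, h₂⟩
      · rintro A B e
        cases e
        have h₁' := PDer.kind_symm h₁
        exact ⟨_, _, rfl, h₁', .kind_symm (h₂.snoc_conv h₁'.kindEq_left h₁')⟩
  | _ => cases hJ

theorem PDer.pi_injective {n : ℕ} {Γ : Ctx C n} {A A' : Kind C n} {B B' : Kind C (n + 1)}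
    (h : PDer S Γ (.kindEq (.pi A B) (.pi A' B'))) :
    PDer S Γ (.kindEq A A') ∧ PDer S (Γ.snoc A) (.kindEq B B') := by
  obtain ⟨_, _, e, hA, hB⟩ := h.kindEq_pi.1 A B rfl
  cases e
  exact ⟨hA, hB⟩

theorem PDer.app_inv {n : ℕ} {Γ : Ctx C n} {f k : Obj C n} {K : Kind C n}
    (h : PDer S Γ (.ofKind (.app f k) K)) :
    ∃ A B, PDer S Γ (.ofKind f (.pi A B)) ∧ PDer S Γ (.ofKind k A) ∧
      PDer S Γ (.kindEq (B.inst k) K) := by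
  generalize hJ : Body.ofKind (.app f k) K = J at h
  induction h with
  | conv _ h₂ ih₁ _ =>
      cases hJ
      obtain ⟨A, B, hf, hk, hB⟩ := ih₁ rfl
      exact ⟨A, B, hf, hk, .kind_trans hB h₂⟩
  | app h₀ h₀' h₁ h₂ _ _ _ _ =>
      cases hJ
      exact ⟨_, _, h₁, h₂, .kind_refl (h₀'.inst h₂)⟩
  | _ => cases hJ

theorem PDer.lam_inv {n : ℕ} {Γ : Ctx C n} {J : Kind C n} {k : Obj C (n + 1)} {K : Kind C n}
    (h : PDer S Γ (.ofKind (.lam J k) K)) :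
    ∃ B, PDer S (Γ.snoc J) (.ofKind k B) ∧ PDer S Γ (.kindEq (.pi J B) K) := by
  generalize hJ : Body.ofKind (.lam J k) K = J at h
  induction h with
  | conv _ h₂ ih₁ _ =>
      cases hJ
      obtain ⟨B, hk, hB⟩ := ih₁ rfl
      exact ⟨B, hk, .kind_trans hB h₂⟩
  | lam h₀ h _ _ =>
      cases hJ
      exact ⟨_, h, .kind_refl (.pi h₀ h.kind_of_ofKind)⟩
  | _ => cases hJ

/-! ### Substitution of equal objects -/

/-- The effect on a judgement of substituting equal objects `σ` and `τ`. -/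
def Body.Functional (S : Spec C) {n m : ℕ} (Γ' : Ctx C m) (σ τ : Sub C n m) : Body C n → Prop
  | .kind K => PDer S Γ' (.kindEq (K.subst σ) (K.subst τ))
  | .ofKind k K => PDer S Γ' (.eq (k.subst σ) (k.subst τ) (K.subst σ))
  | _ => True

/-- The substitutions `σ` and `τ` are typed and componentwise equal. -/
structure TypedEq (S : Spec C) {n m : ℕ} (Γ : Ctx C n) (Γ' : Ctx C m) (σ τ : Sub C n m) :
    Prop where
  left : Typed S Γ Γ' σ
  right : Typed S Γ Γ' τ
  eq : ∀ i, PDer S Γ' (.eq (σ i) (τ i) ((Γ.lookup i).subst σ))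

theorem TypedEq.up {n m : ℕ} {Γ : Ctx C n} {Γ' : Ctx C m} {σ τ : Sub C n m} {K : Kind C n}
    (h : TypedEq S Γ Γ' σ τ) (hK : PDer S Γ' (.kindEq (K.subst σ) (K.subst τ))) :
    TypedEq S (Γ.snoc K) (Γ'.snoc (K.subst σ)) σ.up τ.up := by
  have h₀ := hK.kindEq_left
  have hl := h.left.up h₀
  refine ⟨hl, h.right.up_of_kindEq h₀ hK, Fin.cases (.refl (hl 0)) fun j => ?_⟩
  have := (h.eq j).wk_eq h₀
  rw [← Exp.wk_subst_up] at this
  exact this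

theorem PDer.functional {n m : ℕ} {Γ : Ctx C n} {Γ' : Ctx C m} {σ τ : Sub C n m} {J : Body C n}
    (h : PDer S Γ J) (hστ : TypedEq S Γ Γ' σ τ) (hΓ' : PDer S Γ' .valid) :
    J.Functional S Γ' σ τ := by
  induction h generalizing m with
  | var i _ _ => exact hστ.eq i
  | conv _ h₂ ih₁ _ => exact .conv_eq (ih₁ hστ hΓ') (h₂.subst hστ.left hΓ')
  | type _ _ => exact .kind_refl (.type hΓ')
  | el _ ih => exact .el_eq (ih hστ hΓ')
  | pi _ _ ih₁ ih₂ =>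
      have hK : PDer S Γ' (.kindEq _ _) := ih₁ hστ hΓ'
      exact .pi_eq' hK (ih₂ (hστ.up hK) (.ctxt hK.kindEq_left))
  | lam _ _ ih₀ ih =>
      have hK : PDer S Γ' (.kindEq _ _) := ih₀ hστ hΓ'
      exact .lam_eq' hK (ih (hστ.up hK) (.ctxt hK.kindEq_left))
  | app _ _ _ _ _ ih₀' ih₁ ih₂ =>
      have hk : PDer S Γ' (.eq _ _ _) := ih₂ hστ hΓ'
      simp only [Body.Functional, Exp.inst_subst]
      refine .app_eq ?_ (ih₁ hστ hΓ') hk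
      rw [Exp.subst_up_inst, Exp.subst_up_inst]
      have hl := hστ.left.cons hk.eq_left
      refine ih₀' ⟨hl, hστ.left.cons hk.eq_right, Fin.cases ?_ fun j => .refl (hl j.succ)⟩ hΓ'
      exact (Exp.wk_subst_cons σ _ _).symm ▸ hk
  | const hc hK _ _ _ =>
      simp only [Body.Functional, Exp.closed_subst]
      exact .refl (.const hc hK hΓ')
  | _ => trivial

theorem PDer.inst_kindEq {n : ℕ} {Γ : Ctx C n} {A : Kind C n} {B : Kind C (n + 1)}
    {k k' : Obj C n} (hB : PDer S (Γ.snoc A) (.kind B)) (hk : PDer S Γ (.eq k k' A)) :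
    PDer S Γ (.kindEq (B.inst k) (B.inst k')) := by
  have hl := Typed.single hk.eq_left
  refine hB.functional ⟨hl, Typed.single hk.eq_right, Fin.cases ?_ fun j => .refl (hl j.succ)⟩
    hk.valid
  exact (Exp.wk_subst_single k A).symm ▸ hk

theorem PDer.app_eq' {n : ℕ} {Γ : Ctx C n} {f f' k₁ k₂ : Obj C n} {K : Kind C n}
    {K' : Kind C (n + 1)} (h₁ : PDer S Γ (.eq f f' (.pi K K'))) (h₂ : PDer S Γ (.eq k₁ k₂ K)) :
    PDer S Γ (.eq (.app f k₁) (.app f' k₂) (K'.inst k₁)) :=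
  .app_eq (h₁.eq_left.kind_of_ofKind.pi_inv.2.inst_kindEq h₂) h₁ h₂

/-! ### Spines -/

/-- The object `h g₁ ⋯ gₙ`. -/
abbrev apps {n : ℕ} (h : Obj C n) (gs : List (Obj C n)) : Obj C n := gs.foldl .app h

theorem rename_apps {n m : ℕ} (ρ : Fin n → Fin m) (h : Obj C n) (gs : List (Obj C n)) :
    (apps h gs).rename ρ = apps (h.rename ρ) (gs.map (Exp.rename ρ)) := by
  induction gs generalizing h with
  | nil => rfl
  | cons g gs ih => exact ih _

theorem subst_apps {n m : ℕ} (σ : Sub C n m) (h : Obj C n) (gs : List (Obj C n)) :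
    (apps h gs).subst σ = apps (h.subst σ) (gs.map (Exp.subst σ)) := by
  induction gs generalizing h with
  | nil => rfl
  | cons g gs ih => exact ih _

/-- The arguments `gs` and `gs'` are componentwise equal, and objects of kind `K` can be applied
to them to give objects of kind `K'`. That `gs` alone are suitable arguments is expressed by
taking `gs' = gs`. -/
def SpineEq (S : Spec C) {n : ℕ} (Γ : Ctx C n) (K : Kind C n) :
    List (Obj C n) → List (Obj C n) → Kind C n → Prop
  | [], [], K' => PDer S Γ (.kindEq K K')
  | g :: gs, g' :: gs', K' =>
      ∃ A B, K = .pi A B ∧ PDer S Γ (.eq g g' A) ∧ SpineEq S Γ (B.inst g) gs gs' K'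
  | _, _, _ => False

theorem SpineEq.apps_eq {n : ℕ} {Γ : Ctx C n} {K K' : Kind C n} {gs gs' : List (Obj C n)}
    (h : SpineEq S Γ K gs gs' K') {f f' : Obj C n} (hf : PDer S Γ (.eq f f' K)) :
    PDer S Γ (.eq (apps f gs) (apps f' gs') K') := by
  induction gs generalizing gs' K f f' with
  | nil =>
      cases gs' with
      | nil => exact .conv_eq hf h
      | cons => exact h.elim
  | cons g gs ih =>
      cases gs' with
      | nil => exact h.elim
      | cons g' gs' =>
          obtain ⟨A, B, rfl, hg, h⟩ := h
          exact ih h (.app_eq' hf hg)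

theorem SpineEq.conv {n : ℕ} {Γ : Ctx C n} {K₁ K₂ K' : Kind C n} {gs gs' : List (Obj C n)}
    (h : SpineEq S Γ K₁ gs gs' K') (e : PDer S Γ (.kindEq K₁ K₂)) :
    SpineEq S Γ K₂ gs gs' K' := by
  induction gs generalizing gs' K₁ K₂ with
  | nil =>
      cases gs' with
      | nil => exact .kind_trans (.kind_symm e) h
      | cons => exact h.elim
  | cons g gs ih =>
      cases gs' with
      | nil => exact h.elim
      | cons g' gs' =>
          obtain ⟨A, B, rfl, hg, h⟩ := h
          obtain ⟨A', B', rfl, hA, hB⟩ := e.kindEq_pi.1 A B rfl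
          exact ⟨A', B', rfl, .conv_eq hg hA, ih h (hB.inst hg.eq_left)⟩

theorem PDer.apps_inv {n : ℕ} {Γ : Ctx C n} {K : Kind C n} {f : Obj C n} {gs : List (Obj C n)}
    (h : PDer S Γ (.ofKind (apps f gs) K)) :
    ∃ K₀, PDer S Γ (.ofKind f K₀) ∧ SpineEq S Γ K₀ gs gs K := by
  induction gs generalizing f with
  | nil => exact ⟨K, h, .kind_refl h.kind_of_ofKind⟩
  | cons g gs ih =>
      obtain ⟨K₁, h₁, hs⟩ := ih h
      obtain ⟨A, B, hf, hg, e⟩ := h₁.app_inv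
      exact ⟨.pi A B, hf, A, B, rfl, .refl hg, hs.conv (.kind_symm e)⟩

/-- The kind `(Δ)K`. -/
def Ctx.pis : {n : ℕ} → Ctx C n → Kind C n → Kind C 0
  | _, .nil, K => K
  | _, .snoc Δ J, K => Δ.pis (.pi J K)

/-- The object `[Δ]k`. -/
def Ctx.lams : {n : ℕ} → Ctx C n → Obj C n → Obj C 0
  | _, .nil, k => k
  | _, .snoc Δ J, k => Δ.lams (.lam J k)

/-- Arguments for the kind `(Δ)K` that yield a kind other than a product consist of a substitution
`σ` for `Δ` followed by arguments for `K.subst σ`. Applying `[Δ]k` to them amounts to applying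
`k.subst σ`, by repeated `β`. -/
theorem SpineEq.of_pis {n m : ℕ} {Γ : Ctx C n} {Δ : Ctx C m} {K : Kind C m} {K' : Kind C n}
    {gs : List (Obj C n)} (hΓ : PDer S Γ .valid) (hK' : ∀ A B, K' ≠ .pi A B)
    (h : SpineEq S Γ ((Δ.pis K).rename Fin.elim0) gs gs K') :
    ∃ (σ : Sub C m n) (hs : List (Obj C n)), Typed S Δ Γ σ ∧
      SpineEq S Γ (K.subst σ) hs hs K' ∧ ∀ k, PDer S Δ (.ofKind k K) →
        PDer S Γ (.eq (apps ((Δ.lams k).rename Fin.elim0) gs) (apps (k.subst σ) hs) K') := by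
  induction Δ with
  | nil =>
      have e {s : Cat} (X : Exp C 0 s) : X.subst (fun i => i.elim0 : Sub C 0 n) =
          X.rename Fin.elim0 := by
        rw [Exp.rename_eq_subst]
        congr 1
        funext i
        exact i.elim0
      have ht : Typed S .nil Γ (fun i => i.elim0 : Sub C 0 n) := fun i => i.elim0
      refine ⟨_, gs, ht, (e K).symm ▸ h, fun k hk => ?_⟩
      have := (hk.subst ht hΓ)
      simp only [Body.subst, e] at this ⊢
      exact h.apps_eq (.refl this)
  | snoc Δ J ih =>
      obtain ⟨σ, hs, hσ, h, hβ⟩ := ih h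
      cases hs with
      | nil =>
          obtain ⟨A, B, e, -⟩ := (PDer.kindEq_pi h).1 _ _ rfl
          exact absurd e (hK' A B)
      | cons g hs =>
          obtain ⟨A, B, e, hg, h⟩ := h
          cases e
          rw [Exp.subst_up_inst] at h
          have hg := hg.eq_left
          refine ⟨σ.cons g, hs, hσ.cons hg, h, fun k hk => ?_⟩
          refine .trans (hβ _ (.lam hk.snoc_inv hk)) ?_
          rw [← Exp.subst_up_inst] at h ⊢
          have hJ := hg.kind_of_ofKind
          exact h.apps_eq (.beta hJ (hk.subst (hσ.up hJ) (.ctxt hJ)) hg)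

theorem PDer.lams {m : ℕ} {Δ : Ctx C m} {k : Obj C m} {K : Kind C m}
    (h : PDer S Δ (.ofKind k K)) : PDer S .nil (.ofKind (Δ.lams k) (Δ.pis K)) := by
  induction Δ with
  | nil => exact h
  | snoc Δ J ih => exact ih (.lam h.snoc_inv h)

end Metatheory

end LF

namespace TFk

section

variable {C : Type u} {ar : C → Arity}

/-! ### The translation of renamings and of abstraction sequences -/

/-- The list of the translations `lift(F₁), …, lift(Fₙ)` of an abstraction sequence; expressions
of the other categories have no arguments. -/
def Exp.spine {Φ : Scope} {s : Cat} : Exp ar Φ s → List (LF.Obj C Φ.length)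
  | .cons F Fs => F.lift :: Fs.spine
  | _ => []

theorem Exp.lift_args {Φ : Scope} {α : Arity} (Fs : Args ar Φ α) (h : LF.Obj C Φ.length) :
    Fs.lift h = LF.apps h Fs.spine := by
  induction α generalizing h with
  | nil => cases Fs; rfl
  | cons α β _ ih => cases Fs with
    | cons F Fs => exact ih Fs _

theorem Exp.lift_var {Φ : Scope} {α : Arity} (x : Var Φ α) (Fs : Args ar Φ α) :
    (Exp.var x Fs).lift = LF.apps (.var x.lift) Fs.spine :=
  Fs.lift_args _

theorem Exp.lift_const {Φ : Scope} (c : C) (Fs : Args ar Φ (ar c)) :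
    (Exp.const c Fs).lift = LF.apps (.const c) Fs.spine :=
  Fs.lift_args _

/-- The translation of `Y` is obtained from that of `X` by the renaming `ρ`. -/
def LiftsTo {Φ Ψ : Scope} (ρ : Fin Φ.length → Fin Ψ.length) :
    {s : Cat} → Exp ar Φ s → Exp ar Ψ s → Prop
  | .obj, X, Y => Y.lift = LF.Exp.rename ρ X.lift
  | .args _, X, Y => Y.spine = X.spine.map (LF.Exp.rename ρ)
  | .abs _, X, Y => Y.lift = LF.Exp.rename ρ X.lift
  | .kind _, X, Y => Y.lift = LF.Exp.rename ρ X.lift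

theorem liftsTo_rename {Φ Ψ : Scope} {s : Cat} {ρ : Ren Φ Ψ} {ρ' : Fin Φ.length → Fin Ψ.length}
    (hρ : ∀ (α : Arity) (x : Var Φ α), (ρ α x).lift = ρ' x.lift) (X : Exp ar Φ s) :
    LiftsTo ρ' X (X.rename ρ) := by
  have up {Φ Ψ : Scope} {ρ : Ren Φ Ψ} {ρ' : Fin Φ.length → Fin Ψ.length}
      (hρ : ∀ (α : Arity) (x : Var Φ α), (ρ α x).lift = ρ' x.lift) (β α : Arity)
      (x : Var (β :: Φ) α) : (ρ.up β α x).lift = LF.upRen ρ' x.lift := by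
    cases x with
    | zero => rfl
    | succ x => exact congrArg Fin.succ (hρ _ x)
  induction X generalizing Ψ with
  | var x Fs ih =>
      simp only [LiftsTo, Exp.rename, Exp.lift_var, LF.rename_apps, LF.Exp.rename, hρ]
      exact congrArg _ (ih hρ)
  | const c Fs ih =>
      simp only [LiftsTo, Exp.rename, Exp.lift_const, LF.rename_apps, LF.Exp.rename]
      exact congrArg _ (ih hρ)
  | nil => rfl
  | cons F Fs ih ih' => exact congrArg₂ List.cons (ih hρ) (ih' hρ)
  | body M ih => exact ih hρ
  | lam K F ih ih' => exact congrArg₂ LF.Exp.lam (ih hρ) (ih' (up hρ _))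
  | type => rfl
  | el M ih => exact congrArg LF.Exp.el (ih hρ)
  | pi K K' ih ih' => exact congrArg₂ LF.Exp.pi (ih hρ) (ih' (up hρ _))

theorem lift_wk_kind {Φ : Scope} {α : Arity} (β : Arity) (K : Kind ar Φ α) :
    (K.rename (Ren.wk Φ β)).lift = LF.Exp.wk K.lift :=
  liftsTo_rename (ρ := Ren.wk Φ β) (ρ' := Fin.succ) (fun _ _ => rfl) K

theorem lift_wk_abs {Φ : Scope} {α : Arity} (β : Arity) (F : Abs ar Φ α) :
    (F.rename (Ren.wk Φ β)).lift = LF.Exp.wk F.lift :=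
  liftsTo_rename (ρ := Ren.wk Φ β) (ρ' := Fin.succ) (fun _ _ => rfl) F

theorem lift_closed_kind {α : Arity} (Φ : Scope) (K : Kind ar [] α) :
    (K.rename (Ren.closed Φ)).lift = LF.Exp.rename Fin.elim0 K.lift :=
  liftsTo_rename (ρ := Ren.closed Φ) (ρ' := Fin.elim0) (fun _ x => nomatch x) K

theorem lift_closed_abs {α : Arity} (Φ : Scope) (F : Abs ar [] α) :
    (F.rename (Ren.closed Φ)).lift = LF.Exp.rename Fin.elim0 F.lift :=
  liftsTo_rename (ρ := Ren.closed Φ) (ρ' := Fin.elim0) (fun _ x => nomatch x) F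

theorem Ctx.lift_lookup {Φ : Scope} {α : Arity} (Γ : Ctx ar Φ) (x : Var Φ α) :
    (Γ.lookup x).lift = Γ.lift.lookup x.lift := by
  induction Γ with
  | nil => cases x
  | snoc Γ K ih =>
      cases x with
      | zero => exact lift_wk_kind _ K
      | succ x => exact (lift_wk_kind _ _).trans (congrArg LF.Exp.wk (ih x))

theorem Ctx.lift_pis {Φ : Scope} {α : Arity} (Δ : Ctx ar Φ) (K : Kind ar Φ α) :
    (Δ.pis K).lift = Δ.lift.pis K.lift := by
  induction Δ generalizing α with
  | nil => rfl
  | snoc Δ J ih => exact ih _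

theorem Ctx.lift_lams {Φ : Scope} {α : Arity} (Δ : Ctx ar Φ) (F : Abs ar Φ α) :
    (Δ.lams F).lift = Δ.lift.lams F.lift := by
  induction Δ generalizing α with
  | nil => rfl
  | snoc Δ J ih => exact ih _

/-! ### Instantiation and employment -/

/-- The translation of an image. -/
def Img.lift {α : Arity} {Ψ : Scope} {β : Arity} : Img ar α Ψ β → LF.Obj C Ψ.length
  | .var y => .var y.lift
  | .abs F => F.lift

theorem Img.lift_wk {α : Arity} {Ψ : Scope} {β : Arity} (γ : Arity) (I : Img ar α Ψ β) :
    (I.rename (Ren.wk Ψ γ)).lift = LF.Exp.wk I.lift := by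
  cases I with
  | var y => rfl
  | abs F => exact lift_wk_abs γ F

/-- Whenever the translation of `X` is well-formed over `Γ`, applying the substitution `σ` to it
yields an expression equal over `Γ'` to the translation of `Y`. -/
def SubstEq (S : LF.Spec C) {Φ Ψ : Scope} (Γ : LF.Ctx C Φ.length) (Γ' : LF.Ctx C Ψ.length)
    (σ : LF.Sub C Φ.length Ψ.length) : {s : Cat} → Exp ar Φ s → Exp ar Ψ s → Prop
  | .obj, X, Y => ∀ K, LF.PDer S Γ (.ofKind X.lift K) →
      LF.PDer S Γ' (.eq (LF.Exp.subst σ X.lift) Y.lift (K.subst σ))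
  | .args _, X, Y => ∀ K K', LF.SpineEq S Γ K X.spine X.spine K' →
      LF.SpineEq S Γ' (K.subst σ) (X.spine.map (LF.Exp.subst σ)) Y.spine (K'.subst σ)
  | .abs _, X, Y => ∀ K, LF.PDer S Γ (.ofKind X.lift K) →
      LF.PDer S Γ' (.eq (LF.Exp.subst σ X.lift) Y.lift (K.subst σ))
  | .kind _, X, Y => LF.PDer S Γ (.kind X.lift) →
      LF.PDer S Γ' (.kindEq (LF.Exp.subst σ X.lift) Y.lift)

/-- The operation `emp` agrees with iterated application, on all translations for which the
latter is well-typed. -/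
def EmployEq (S : LF.Spec C) {α : Arity}
    (emp : ∀ Ψ : Scope, Abs ar Ψ α → Args ar Ψ α → Obj ar Ψ) : Prop :=
  ∀ (Φ : Scope) (Γ : LF.Ctx C Φ.length) (F : Abs ar Φ α) (Gs : Args ar Φ α)
    (K : LF.Kind C Φ.length), LF.PDer S Γ (.ofKind (LF.apps F.lift Gs.spine) K) →
      LF.PDer S Γ (.eq (LF.apps F.lift Gs.spine) (emp Φ F Gs).lift K)

/-- If employment agrees with iterated application, then instantiation agrees with substitution:
the two differ only where an abstraction is substituted for the head of an object. -/
theorem EmployEq.substEq {S : LF.Spec C} {α : Arity}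
    {emp : ∀ Ψ : Scope, Abs ar Ψ α → Args ar Ψ α → Obj ar Ψ} (hemp : EmployEq S emp)
    {Φ Ψ : Scope} {s : Cat} {σ : Inst ar α Φ Ψ} {σ' : LF.Sub C Φ.length Ψ.length}
    (hσ : ∀ (β : Arity) (x : Var Φ β), σ' x.lift = (σ β x).lift)
    {Γ : LF.Ctx C Φ.length} {Γ' : LF.Ctx C Ψ.length} (ht : LF.Typed S Γ Γ' σ')
    (hΓ' : LF.PDer S Γ' .valid) (X : Exp ar Φ s) : SubstEq S Γ Γ' σ' X (X.instWith emp σ) := by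
  have up {Φ Ψ : Scope} {σ : Inst ar α Φ Ψ} {σ' : LF.Sub C Φ.length Ψ.length}
      (hσ : ∀ (β : Arity) (x : Var Φ β), σ' x.lift = (σ β x).lift) (γ β : Arity)
      (x : Var (γ :: Φ) β) : σ'.up x.lift = (σ.up γ β x).lift := by
    cases x with
    | zero => rfl
    | succ x => exact (congrArg LF.Exp.wk (hσ _ x)).trans (Img.lift_wk γ _).symm
  induction X generalizing Ψ with
  | @var _ β x Fs ih =>
      intro K h
      rw [Exp.lift_var] at h ⊢
      rw [LF.subst_apps]
      obtain ⟨K₀, hx, hs⟩ := h.apps_inv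
      have hx : LF.PDer S Γ' (.ofKind (σ' x.lift) _) := hx.subst ht hΓ'
      have e := (ih hσ ht hΓ' _ _ hs).apps_eq (.refl hx)
      refine .trans e ?_
      have hr := e.eq_right
      rw [hσ] at hr ⊢
      change LF.PDer S Γ' (.eq _ ((σ β x).apply (emp Ψ) (Fs.instWith emp σ)).lift _)
      generalize σ β x = I at hr ⊢
      cases I with
      | var y =>
          rw [Img.apply, Exp.lift_var]
          exact .refl hr
      | abs F => exact hemp _ _ _ _ _ hr
  | const c Fs ih =>
      intro K h
      change LF.PDer S Γ' (.eq _ (Exp.const c (Fs.instWith emp σ)).lift _)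
      rw [Exp.lift_const] at h
      rw [Exp.lift_const, Exp.lift_const, LF.subst_apps]
      obtain ⟨K₀, hc, hs⟩ := h.apps_inv
      exact (ih hσ ht hΓ' _ _ hs).apps_eq (.refl (hc.subst ht hΓ'))
  | nil => exact fun K K' h => h.subst ht hΓ'
  | cons F Fs ih ih' =>
      rintro K K' ⟨A, B, rfl, hF, hs⟩
      refine ⟨_, _, rfl, ih hσ ht hΓ' _ hF.eq_left, ?_⟩
      rw [← LF.Exp.inst_subst]
      exact ih' hσ ht hΓ' _ _ hs
  | body M ih => exact ih hσ ht hΓ'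
  | @lam Φ γ _ J F ih ih' =>
      intro K h
      obtain ⟨B, hF, hB⟩ := LF.PDer.lam_inv h
      have hJ := hF.snoc_inv
      have hJ' : LF.PDer S Γ' (.kind _) := hJ.subst ht hΓ'
      refine .conv_eq ?_ (hB.subst ht hΓ')
      have hF' : SubstEq S (Φ := γ :: Φ) (Ψ := γ :: Ψ) _ _ _ F _ :=
        ih' (up hσ γ) (ht.up hJ') (.ctxt hJ')
      exact .lam_eq hJ' (ih hσ ht hΓ' hJ) (hF' B hF)
  | type => exact fun _ => .kind_refl (.type hΓ')
  | el M ih =>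
      intro h
      exact .el_eq (ih hσ ht hΓ' _ (LF.PDer.el_inv h))
  | @pi Φ γ _ K K' ih ih' =>
      intro h
      have h := LF.PDer.pi_inv h
      have hK' : LF.PDer S Γ' (.kind _) := h.1.subst ht hΓ'
      have e : SubstEq S (Φ := γ :: Φ) (Ψ := γ :: Ψ) _ _ _ K' _ :=
        ih' (up hσ γ) (ht.up hK') (.ctxt hK')
      exact .pi_eq hK' (ih hσ ht hΓ' h.1) (e h.2)

theorem EmployEq.inst {S : LF.Spec C} {α : Arity} (hemp : EmployEq (ar := ar) S (employ α))
    {Φ : Scope} {s : Cat} {Γ : LF.Ctx C Φ.length} {A : LF.Kind C Φ.length} {G : Abs ar Φ α}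
    (hG : LF.PDer S Γ (.ofKind G.lift A)) (X : Exp ar (α :: Φ) s) :
    SubstEq S (Φ := α :: Φ) (Γ.snoc A) Γ (LF.single G.lift) X (X.inst G) := by
  refine hemp.substEq (fun β x => ?_) (.single hG) hG.valid X
  cases x <;> rfl

/-- Employment agrees with iterated application, by `β`: in `([x : J]F) G₁ ⋯ Gₙ` the label `J` is
equal to the kind of `G₁` since product kinds are injective, and `G₁` has smaller arity than the
abstraction. -/
theorem employEq_employ (S : LF.Spec C) (α : Arity) : EmployEq (ar := ar) S (employ α) := by
  induction α with
  | nil =>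
      intro Φ Γ F Gs K h
      cases F; cases Gs
      exact .refl h
  | cons α β ihα ihβ =>
      intro Φ Γ F Gs K h
      cases F with
      | lam J F =>
        cases Gs with
        | cons G Gs =>
          obtain ⟨K₀, hF, hs⟩ := h.apps_inv
          obtain ⟨A, B, rfl, hG, hs⟩ := hs
          obtain ⟨B', hF, hB⟩ := LF.PDer.lam_inv hF
          obtain ⟨hJ, hB⟩ := hB.pi_injective
          have hG' := LF.PDer.conv hG.eq_left hJ.kind_symm
          have hβ := LF.PDer.beta hF.snoc_inv hF hG'
          have hi := ihα.inst hG' F _ hF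
          have e := hs.apps_eq (.conv_eq (.trans hβ hi) (hB.inst hG'))
          exact .trans e (ihβ Φ Γ (F.inst G) Gs K e.eq_right)

/-- On well-formed translations, instantiation agrees with substitution. -/
theorem lift_inst {S : LF.Spec C} {α β : Arity} {Φ : Scope} {Γ : LF.Ctx C Φ.length}
    {A : LF.Kind C Φ.length} {G : Abs ar Φ α} (hG : LF.PDer S Γ (.ofKind G.lift A))
    {K : Kind ar (α :: Φ) β} (hK : LF.PDer S (Γ.snoc A) (.kind K.lift)) :
    LF.PDer S Γ (.kindEq (LF.Exp.inst K.lift G.lift) (K.inst G).lift) :=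
  (employEq_employ S α).inst hG K hK

/-! ### The translation of judgements -/

/-- The translation of a primitive judgement is derivable. -/
def Judgement.Holds (S : LF.Spec C) (J : Judgement ar) : Prop :=
  LF.PDer S J.lift.ctx J.lift.body

/-- A defined judgement holds when it is defined and the translations of its members are
derivable. -/
structure DefinedJudgement.Holds (S : LF.Spec C) (D : DefinedJudgement ar) : Prop where
  isDefined : D.isDefined
  primitives : ∀ J ∈ D.primitives, J.Holds S

theorem DefinedJudgement.Holds.of_singleton {S : LF.Spec C} {J : Judgement ar}
    (h : (DefinedJudgement.of {J}).Holds S) : J.Holds S :=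
  h.primitives J rfl

theorem DefinedJudgement.Holds.of_union {S : LF.Spec C} {D E : DefinedJudgement ar}
    (h : (D.union E).Holds S) : D.Holds S ∧ E.Holds S :=
  ⟨⟨h.1.1, fun J hJ => h.2 J (.inl hJ)⟩, ⟨h.1.2, fun J hJ => h.2 J (.inr hJ)⟩⟩

variable {S : LF.Spec C}

theorem kind_of_kindJ {α : Arity} {Φ : Scope} {Γ : Ctx ar Φ} {K : Kind ar Φ α}
    (h : (kindJ α Γ K).Holds S) : LF.PDer S Γ.lift (.kind K.lift) := by
  induction α generalizing Φ with
  | nil =>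
      cases K with
      | type => exact .type h.of_singleton
      | el M => exact .el h.of_singleton
  | cons α β _ ih =>
      cases K with
      | pi K K' =>
          have h := ih h
          exact .pi (LF.PDer.snoc_inv h) h

theorem kindEq_of_kindEqJ {α : Arity} {Φ : Scope} {Γ : Ctx ar Φ} {K K' : Kind ar Φ α}
    (h : (kindEqJ α Γ K K').Holds S) : LF.PDer S Γ.lift (.kindEq K.lift K'.lift) := by
  induction α generalizing Φ with
  | nil =>
      cases K with
      | type =>
          cases K' with
          | type => exact .kind_refl (.type h.of_singleton)
          | el M => exact h.1.elim
      | el M =>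
          cases K' with
          | type => exact h.1.elim
          | el M => exact .el_eq h.of_singleton
  | cons α β ihα ihβ =>
      cases K with
      | pi K L =>
        cases K' with
        | pi K' L' =>
            have h := h.of_union
            exact .pi_eq' (ihα h.1) (ihβ h.2)

theorem ofKind_of_absJ {α : Arity} {Φ : Scope} {Γ : Ctx ar Φ} {F : Abs ar Φ α}
    {K : Kind ar Φ α} (h : (absJ α Γ F K).Holds S) :
    LF.PDer S Γ.lift (.ofKind F.lift K.lift) := by
  induction α generalizing Φ with
  | nil =>
      cases F with
      | body M => exact h.of_singleton
  | cons α β _ ih =>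
      cases F with
      | lam J F =>
        cases K with
        | pi K K' =>
            have h := h.of_union
            exact (LF.PDer.lam_eq' (kindEq_of_kindEqJ h.1) (.refl (ih h.2))).eq_right

theorem eq_of_absEqJ {α : Arity} {Φ : Scope} {Γ : Ctx ar Φ} {F G : Abs ar Φ α}
    {K : Kind ar Φ α} (h : (absEqJ α Γ F G K).Holds S) :
    LF.PDer S Γ.lift (.eq F.lift G.lift K.lift) := by
  induction α generalizing Φ with
  | nil =>
      cases F with
      | body M =>
        cases G with
        | body N => exact h.of_singleton
  | cons α β _ ih =>
      cases F with
      | lam J₁ F =>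
        cases G with
        | lam J₂ G =>
          cases K with
          | pi K K' =>
              have h₁ := h.of_union
              have h₂ := h₁.1.of_union
              have e := ih h₁.2
              -- both abstractions equal the one over `F` with the label taken from the kind
              have hF : LF.PDer S (Γ.lift.snoc K.lift) (.ofKind F.lift K'.lift) := e.eq_left
              exact .trans (.symm (.lam_eq' (kindEq_of_kindEqJ h₂.1) (.refl hF)))
                (.lam_eq' (kindEq_of_kindEqJ h₂.2) e)

theorem spineEq_of_seqEqJ {α : Arity} {Φ : Scope} {Γ : Ctx ar Φ} {Fs Gs : Args ar Φ α}
    {K : Kind ar Φ α} (hK : LF.PDer S Γ.lift (.kind K.lift))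
    (h : (seqEqJ α Γ Fs Gs K).Holds S) :
    LF.SpineEq S Γ.lift K.lift Fs.spine Gs.spine (instResult α K Fs).lift := by
  induction α with
  | nil =>
      cases Fs; cases Gs
      exact .kind_refl hK
  | cons α β _ ih =>
      cases Fs with
      | cons F Fs =>
        cases Gs with
        | cons G Gs =>
          cases K with
          | pi K K' =>
              have h := h.of_union
              have e := eq_of_absEqJ h.1
              have hi := lift_inst e.eq_left (LF.PDer.pi_inv hK).2
              exact ⟨_, _, rfl, e, (ih hi.kindEq_right h.2).conv hi.kind_symm⟩

theorem spineEq_of_seqJ {α : Arity} {Φ : Scope} {Γ : Ctx ar Φ} {Fs : Args ar Φ α}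
    {K : Kind ar Φ α} (hK : LF.PDer S Γ.lift (.kind K.lift)) (h : (seqJ α Γ Fs K).Holds S) :
    LF.SpineEq S Γ.lift K.lift Fs.spine Fs.spine (instResult α K Fs).lift := by
  induction α with
  | nil =>
      cases Fs
      exact .kind_refl hK
  | cons α β _ ih =>
      cases Fs with
      | cons F Fs =>
        cases K with
        | pi K K' =>
            have h := h.of_union
            have hF := ofKind_of_absJ h.1
            have hi := lift_inst hF (LF.PDer.pi_inv hK).2
            exact ⟨_, _, rfl, .refl hF, (ih hi.kindEq_right h.2).conv hi.kind_symm⟩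

theorem valid_of_seqJ {α : Arity} {Φ : Scope} {Γ : Ctx ar Φ} {Fs : Args ar Φ α}
    {K : Kind ar Φ α} (h : (seqJ α Γ Fs K).Holds S) : LF.PDer S Γ.lift .valid := by
  induction α with
  | nil => exact h.of_singleton
  | cons α β _ ih =>
      cases Fs with
      | cons F Fs =>
        cases K with
        | pi K K' => exact ih h.of_union.2

theorem valid_of_seqEqJ {α : Arity} {Φ : Scope} {Γ : Ctx ar Φ} {Fs Gs : Args ar Φ α}
    {K : Kind ar Φ α} (h : (seqEqJ α Γ Fs Gs K).Holds S) : LF.PDer S Γ.lift .valid := by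
  induction α with
  | nil => exact h.of_singleton
  | cons α β _ ih =>
      cases Fs with
      | cons F Fs =>
        cases Gs with
        | cons G Gs =>
          cases K with
          | pi K K' => exact ih h.of_union.2

theorem lift_baseKind_ne_pi {Φ : Scope} (T : BaseKind ar Φ) (A : LF.Kind C Φ.length)
    (B : LF.Kind C (Φ.length + 1)) : T.lift ≠ LF.Exp.pi A B := by
  cases T <;> exact fun h => nomatch h

/-! ### Soundness of the translation -/

/-- The translation of the declaration is well-formed. For an equation declaration, its kind is
well-formed because it is the kind of both sides. -/
def Decl.LiftWellFormed (S : LF.Spec C) : Decl ar → Prop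
  | .const _ K => LF.PDer S .nil (.kind K.lift)
  | .eq Δ M N T => LF.PDer S Δ.lift (.ofKind M.lift T.lift) ∧
      LF.PDer S Δ.lift (.ofKind N.lift T.lift)

/-- The translation is sound as soon as the declarations have well-formed translations. -/
theorem Derivable.holds {S₀ : Spec ar} {S : LF.Spec C} (hS : ∀ δ ∈ S₀, δ.lift ∈ S)
    (hwf : ∀ δ ∈ S₀, δ.LiftWellFormed S) {J : Judgement ar} (h : Derivable S₀ J) :
    J.Holds S := by
  have closed_kind {n m : ℕ} {Γ : LF.Ctx C n} {K : LF.Kind C 0} (hΓ : LF.PDer S Γ .valid)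
      (hK : LF.PDer S .nil (.kind K)) : LF.PDer S Γ (.kind (K.rename Fin.elim0)) := by
    rw [LF.Exp.rename_eq_subst]
    exact hK.subst (fun i => i.elim0) hΓ
  induction h with
  | emp_ctxt => exact .emp
  | ctxt hd _ ih => exact .ctxt (kind_of_kindJ ⟨hd, ih⟩)
  | @var Φ α Γ x Fs hd _ ih =>
      have hx := LF.PDer.var x.lift (valid_of_seqJ ⟨hd, ih⟩)
      rw [← Ctx.lift_lookup] at hx
      have := (spineEq_of_seqJ hx.kind_of_ofKind ⟨hd, ih⟩).apps_eq (.refl hx)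
      rw [← Exp.lift_var] at this
      exact this.eq_left
  | @var_eq Φ α Γ x Fs Gs hd _ ih =>
      have hx := LF.PDer.var x.lift (valid_of_seqEqJ ⟨hd, ih⟩)
      rw [← Ctx.lift_lookup] at hx
      have := (spineEq_of_seqEqJ hx.kind_of_ofKind ⟨hd, ih⟩).apps_eq (.refl hx)
      rw [← Exp.lift_var, ← Exp.lift_var] at this
      exact this
  | ref _ ih => exact .refl ih
  | sym _ ih => exact .symm ih
  | trans _ _ ih₁ ih₂ => exact .trans ih₁ ih₂
  | conv _ _ ih₁ ih₂ => exact .conv ih₁ (.el_eq ih₂)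
  | conv_eq _ _ ih₁ ih₂ => exact .conv_eq ih₁ (.el_eq ih₂)
  | @const Φ Γ c K Fs hc hd _ ih =>
      have hx := LF.PDer.const (hS _ hc) (hwf _ hc) (valid_of_seqJ ⟨hd, ih⟩)
      rw [← lift_closed_kind] at hx
      have := (spineEq_of_seqJ hx.kind_of_ofKind ⟨hd, ih⟩).apps_eq (.refl hx)
      rw [← Exp.lift_const] at this
      exact this.eq_left
  | @const_eq Φ Γ c K Fs Gs hc hd _ ih =>
      have hx := LF.PDer.const (hS _ hc) (hwf _ hc) (valid_of_seqEqJ ⟨hd, ih⟩)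
      rw [← lift_closed_kind] at hx
      have := (spineEq_of_seqEqJ hx.kind_of_ofKind ⟨hd, ih⟩).apps_eq (.refl hx)
      rw [← Exp.lift_const, ← Exp.lift_const] at this
      exact this
  | @eq Φ Θ Γ Δ M N T Fs he hd _ ih =>
      have hΓ := valid_of_seqJ ⟨hd, ih⟩
      obtain ⟨hM, hN⟩ := hwf _ he
      have hT : LF.PDer S Γ.lift (.kind ((Δ.pis T).rename (Ren.closed Φ)).lift) := by
        rw [lift_closed_kind, Ctx.lift_pis]
        exact closed_kind (m := 0) hΓ hM.lams.kind_of_ofKind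
      have hs := spineEq_of_seqJ hT ⟨hd, ih⟩
      -- both sides of the instance are compared with `[Δ]P` applied to the arguments, which
      -- equals the employment here and the substitution instance of `P` by `hβ` below
      have employ_eq {P : Obj ar Θ} (hP : LF.PDer S Δ.lift (.ofKind P.lift T.lift)) :
          LF.PDer S Γ.lift (.eq
            (LF.apps ((Δ.lift.lams P.lift).rename Fin.elim0) Fs.spine)
            (employ _ Φ ((Δ.lams (.body P)).rename (Ren.closed Φ)) Fs).lift
            (instResult _ ((Δ.pis T).rename (Ren.closed Φ)) Fs).lift) := by
        have hL : LF.PDer S Γ.lift (.ofKind ((Δ.lams (.body P)).rename (Ren.closed Φ)).lift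
            ((Δ.pis T).rename (Ren.closed Φ)).lift) := by
          rw [lift_closed_kind, lift_closed_abs, Ctx.lift_pis, Ctx.lift_lams,
            LF.Exp.rename_eq_subst, LF.Exp.rename_eq_subst]
          exact hP.lams.subst (fun i => i.elim0) hΓ
        have := employEq_employ S _ _ _ _ _ _ (hs.apps_eq (.refl hL)).eq_left
        rw [lift_closed_abs, Ctx.lift_lams] at this
        exact this
      have hs' := hs
      rw [lift_closed_kind, Ctx.lift_pis] at hs'
      obtain ⟨σ, gs, hσ, hgs, hβ⟩ := hs'.of_pis hΓ (lift_baseKind_ne_pi _)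
      -- no arguments are left over, since `T` is a base kind
      cases gs with
      | cons g gs =>
          obtain ⟨A, B, e, -⟩ := hgs
          cases T <;> cases e
      | nil =>
          have hc := LF.PDer.comp (hS _ he) hΓ hσ (hM.subst hσ hΓ) (hN.subst hσ hΓ)
          exact .trans (.symm (employ_eq hM)) (.trans (hβ _ hM)
            (.trans (.conv_eq hc hgs) (.trans (.symm (hβ _ hN)) (employ_eq hN))))

/-- In an orderable specification every declaration has a well-formed translation, by induction
along the ordering. -/
theorem Spec.Orderable.liftWellFormed {S : Spec ar} (hS : S.Orderable) :
    ∀ δ ∈ S, δ.LiftWellFormed S.lift := by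
  obtain ⟨r, hr, hwf⟩ := hS
  suffices ∀ δ : {δ : Decl ar // δ ∈ S}, δ.1.LiftWellFormed S.lift from fun δ h => this ⟨δ, h⟩
  intro δ
  induction δ using hr.wf.induction with
  | h δ ih =>
      have holds {J : Judgement ar} (h : Derivable {δ' | ∃ h : δ' ∈ S, r ⟨δ', h⟩ δ} J) :
          J.Holds S.lift :=
        h.holds (fun δ' h => Set.mem_image_of_mem _ h.1) fun δ' h => ih ⟨δ', h.1⟩ h.2
      have h := hwf δ
      obtain ⟨δ, hδ⟩ := δ
      cases δ with
      | const c K => exact kind_of_kindJ ⟨h.1, fun J hJ => holds (h.2 J hJ)⟩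
      | eq Δ M N T => exact ⟨holds h.1, holds h.2.1⟩

end

end TFk

theorem mainTheorem5 {C : Type*} (ar : C → TFk.Arity) (S : TFk.Spec ar) (hS : S.Orderable)
    (J : TFk.Judgement ar) (hJ : TFk.Derivable S J) :
    LF.Derivable S.lift J.lift :=
  (hJ.holds (fun _ h => Set.mem_image_of_mem _ h) hS.liftWellFormed).der
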